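/- Everything is over $\mathbb C$ and holomorphic. Let $V$ be a finite-dimensional complex vector space and $Z\subset\mathbb P V$ a non-singular projective variety, where $\mathbb P V$ is the space of lines in $V$. For $\alpha\in Z$ write $\hat\alpha\subset V$ for the corresponding line and $\hat T_\alpha(Z)=T_u(\hat Z)\subset V$ ($0\ne u\in\hat\alpha$) for the affine tangent space, where $\hat Z\subset V$ is the cone over $Z$. Let $$\Xi_Z=\{\sigma\in\mathrm{Hom}(\wedge^2V,V):\ \sigma(u,v)\in\hat T_\alpha(Z)\ \text{whenever } \alpha\in Z,\ u\in\hat\alpha,\ v\in\hat T_\alpha(Z)\}.$$ Let $M$ be a complex manifold with $\dim M=\dim V$, and let $\mathcal C\subset\mathbb P T(M)$ be a $Z$-isotrivial cone structure: $\mathcal C$ is a complex submanifold, the projection $\varpi:\mathcal C\to M$ is a submersion with connected fibres, and for every $x\in M$ the fibre $\mathcal C_x\subset\mathbb P T_x(M)$ is projectively equivalent to $Z\subset\mathbb P V$. Let $\omega$ be an adapted coframe: a holomorphic $V$-valued $1$-form on $M$ such that each $\omega_x:T_x(M)\to V$ is an isomorphism that sends $\mathcal C_x$ to $Z$. Its structure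 function $\sigma^\omega:M\to\mathrm{Hom}(\wedge^2V,V)$ is defined by $d\omega=\sigma^\omega_\sharp(\omega\wedge\omega)$, where $(\omega\wedge\omega)(X,Y)=\omega(X)\otimes\omega(Y)-\omega(Y)\otimes\omega(X)$. Let $\pi:T(M)\to M$ be the projection and let $\mu:T(M)\to V$ be the function $v\mapsto\omega(v)$. The geodesic flow of $\omega$ is the vector field $\gamma$ on $T(M)$ determined by $d\pi_u(\gamma_u)=u$ and $d\mu(\gamma)=0$. It is tangent to the cone over $\mathcal C$, and its image under $T(M)\setminus 0\to\mathbb P T(M)$ spans a line subbundle $\Gamma\subset T(\mathcal C)$, which is a conic connection, i.e. it is mapped by $d\varpi$ isomorphically onto the tautological line $\hat\alpha\subset T_x(M)$ at every $\alpha\in\mathcal C_x$. Let $\mathcal P\subset T(\mathcal C)$ be the subbundle with fibre $d\varpi_\alpha^{-1}(\hat T_\alpha(\mathcal C_x))$ at $\alpha\in\mathcal C_x$. Suppose that $\Gamma$ is a characteristic connection, i.e. for all local sections $v$ of $\mathcal P$ and $w$ of $\Gamma$, regarded as local vector fields on $\mathcal C$, the Lie bracket $[v,w]$ is again a local section of $\mathcal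 P$. Then $\sigma^\omega(x)\in\Xi_Z$ for every $x\in M$. -/

import Mathlib

open Manifold ContDiff Topology
open scoped LinearAlgebra.Projectivization

namespace ConicConnections

section Projective

variable {W : Type*} [AddCommGroup W] [Module ℂ W]

/-- The affine cone `Ŝ ⊆ W` over a subset `S` of the projective space `ℙ W` of lines in `W`. -/
def affineCone (S : Set (ℙ ℂ W)) : Set W :=
  {w | ∀ hw : w ≠ 0, Projectivization.mk ℂ w hw ∈ S}

/-- The affine tangent space `T̂_α(S) = T_u(Ŝ) ⊆ W`, `0 ≠ u ∈ α`: the span of the velocities at `u`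
of the germs of holomorphic curves through `u` that lie on the cone `Ŝ`.  When `Ŝ ∖ 0` is a complex
submanifold of `W`, as it is for a non-singular projective variety, this is the usual tangent space
of that submanifold at `u` (and it does not depend on `u`). -/
def affineTangentSpace [TopologicalSpace W] [ContinuousSMul ℂ W] (S : Set (ℙ ℂ W)) (α : ℙ ℂ W) :
    Submodule ℂ W :=
  Submodule.span ℂ {w | ∃ c : ℂ → W, c 0 ≠ 0 ∧ c 0 ∈ α.submodule ∧
    (∀ᶠ t in 𝓝 (0 : ℂ), DifferentiableAt ℂ c t ∧ c t ∈ affineCone S) ∧ HasDerivAt c w 0}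

/-- The algebra `Sym V*` of polynomial functions on `W`. -/
def polynomialFunctions (W : Type*) [AddCommGroup W] [Module ℂ W] : Subalgebra ℂ (W → ℂ) :=
  Algebra.adjoin ℂ (Set.range fun (l : Module.Dual ℂ W) (w : W) => l w)

/-- The coordinate ring `ℂ[X]` of a subset `X ⊆ W`: the restrictions to `X` of the polynomial
functions. -/
def coordinateRing (X : Set W) : Subalgebra ℂ (X → ℂ) :=
  Algebra.adjoin ℂ (Set.range fun (l : Module.Dual ℂ W) (x : X) => l x)

end Projective

section Varieties

variable {V : Type*} [NormedAddCommGroup V] [NormedSpace ℂ V]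

/-- The Zariski tangent space at `u` of `X ⊆ V`: the common kernel of the differentials at `u` of
the polynomial functions vanishing on `X`. -/
noncomputable def zariskiTangentSpace (X : Set V) (u : V) : Submodule ℂ V :=
  ⨅ g ∈ {g : V → ℂ | g ∈ polynomialFunctions V ∧ ∀ x ∈ X, g x = 0},
    (fderiv ℂ g u).toLinearMap.ker

/-- `Z ⊆ ℙ V` is a non-singular projective variety: it is non-empty, it is the zero locus of a set
of homogeneous polynomials, it is irreducible (its homogeneous coordinate ring is a domain), and at
every point the Zariski tangent space of the cone over `Z` has the dimension of that cone. -/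
structure IsNonsingularProjectiveVariety (Z : Set (ℙ ℂ V)) : Prop where
  nonempty : Z.Nonempty
  algebraic : ∃ S : Set (V → ℂ),
    (∀ g ∈ S, g ∈ polynomialFunctions V ∧ ∃ d : ℕ, ∀ (t : ℂ) (v : V), g (t • v) = t ^ d * g v) ∧
    Z = {α | ∀ g ∈ S, ∀ v ∈ α.submodule, g v = 0}
  irreducible : IsDomain (coordinateRing (affineCone Z))
  nonsingular : ∀ u ∈ affineCone Z, u ≠ 0 →
    (Module.finrank ℂ (zariskiTangentSpace (affineCone Z) u) : WithBot ℕ∞) =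
      ringKrullDim (coordinateRing (affineCone Z))

/-- The subspace `Ξ_Z` of `Hom(∧² V, V)`: the `σ` such that `σ(u, v) ∈ T̂_α(Z)` whenever `α ∈ Z`,
`u ∈ α̂` and `v ∈ T̂_α(Z)`. -/
def Xi (Z : Set (ℙ ℂ V)) : Submodule ℂ (V [⋀^Fin 2]→ₗ[ℂ] V) where
  carrier := {σ | ∀ α ∈ Z, ∀ u ∈ α.submodule, ∀ v ∈ affineTangentSpace Z α,
    σ ![u, v] ∈ affineTangentSpace Z α}
  zero_mem' := fun _ _ _ _ _ _ => Submodule.zero_mem _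
  add_mem' := fun hσ hτ α hα u hu v hv =>
    Submodule.add_mem _ (hσ α hα u hu v hv) (hτ α hα u hu v hv)
  smul_mem' := fun a _ hσ α hα u hu v hv => Submodule.smul_mem _ a (hσ α hα u hu v hv)

end Varieties

/-- The projectivized tangent bundle `ℙ T(M)` of a complex manifold `M` modelled on `E`: its points
are the pairs of a point `base` of `M` and a line in the tangent space of `M` at that point. -/
structure ProjTangentBundle (E M : Type*) [NormedAddCommGroup E] [NormedSpace ℂ E]
    [TopologicalSpace M] [ChartedSpace E M] where
  base : M
  line : ℙ ℂ (TangentSpace 𝓘(ℂ, E) base)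

/-! ### The complex manifold structure of `ℙ T(M)` -/

namespace ProjTangentBundle

variable {E M : Type*} [NormedAddCommGroup E] [NormedSpace ℂ E]
    [TopologicalSpace M] [ChartedSpace E M]

/-- The space `ℂ^(dim E - 1)` of affine coordinates on `ℙ(E)`. -/
abbrev AffineModel (E : Type*) [NormedAddCommGroup E] [NormedSpace ℂ E] : Type :=
  EuclideanSpace ℂ (Fin (Module.finrank ℂ E - 1))

section
variable [IsManifold 𝓘(ℂ, E) ω M]

/-- Coordinate change `D(φ' ∘ φ⁻¹)` of the tangent bundle at `x`, between two charts of `M`. -/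
noncomputable abbrev cc (φ φ' : atlas E M) (x : M) : E →L[ℂ] E :=
  (tangentBundleCore 𝓘(ℂ, E) M).coordChange φ φ' x

lemma cc_comp (i j k : atlas E M) {x : M} (hi : x ∈ i.1.source) (hj : x ∈ j.1.source)
    (hk : x ∈ k.1.source) (v : E) : cc j k x (cc i j x v) = cc i k x v :=
  (tangentBundleCore 𝓘(ℂ, E) M).coordChange_comp i j k x ⟨⟨hi, hj⟩, hk⟩ v

lemma cc_self (i : atlas E M) {x : M} (hi : x ∈ i.1.source) (v : E) : cc i i x v = v :=
  (tangentBundleCore 𝓘(ℂ, E) M).coordChange_self i x hi v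

lemma cc_ne_zero (i j : atlas E M) {x : M} (hi : x ∈ i.1.source) (hj : x ∈ j.1.source)
    {v : E} (hv : v ≠ 0) : cc i j x v ≠ 0 := by
  intro h
  apply hv
  rw [← cc_self i hi v, ← cc_comp i j i hi hj hi v, h, map_zero]

/-- In linear coordinates `A v = (s, t)` on `E`, the affine coordinate `t / s` of the line
spanned by `v` (meaningful where `s ≠ 0`). -/
noncomputable def affineCoord (A : E ≃L[ℂ] ℂ × AffineModel E) (v : E) : AffineModel E :=
  (A v).1⁻¹ • (A v).2

lemma affineCoord_smul (A : E ≃L[ℂ] ℂ × AffineModel E) (v : E) {a : ℂ} (ha : a ≠ 0) :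
    affineCoord A (a • v) = affineCoord A v := by
  simp only [affineCoord, map_smul, Prod.smul_fst, Prod.smul_snd, smul_eq_mul, mul_inv, smul_smul]
  congr 1
  field_simp

/-- The coordinates, in the chart `φ` of `M`, of a vector spanning the line `p`. -/
noncomputable def vec (φ : atlas E M) (p : ProjTangentBundle E M) : E :=
  cc (achart E p.base) φ p.base p.line.rep

lemma vec_mk (φ : atlas E M) (x : M) (w : TangentSpace 𝓘(ℂ, E) x) (hw : w ≠ 0) :
    ∃ a : ℂ, a ≠ 0 ∧ vec φ ⟨x, Projectivization.mk ℂ w hw⟩ = a • cc (achart E x) φ x w := by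
  obtain ⟨a, ha⟩ := Projectivization.exists_smul_eq_mk_rep ℂ w hw
  refine ⟨a, a.ne_zero, ?_⟩
  rw [vec, ← ha]
  exact (cc (achart E x) φ x).map_smul (a : ℂ) w

/-- The line over `φ⁻¹(z.1)` whose affine coordinate is `z.2`. (The second case of the `if`
only occurs for `z.1` outside the target of `φ`.) -/
noncomputable def ofCoord (φ : atlas E M) (A : E ≃L[ℂ] ℂ × AffineModel E)
    (z : E × AffineModel E) : ProjTangentBundle E M where
  base := φ.1.symm z.1
  line :=
    haveI := Classical.dec
    if h : cc φ (achart E (φ.1.symm z.1)) (φ.1.symm z.1) (A.symm (1, z.2)) ≠ 0 then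
      Projectivization.mk ℂ (V := TangentSpace 𝓘(ℂ, E) (φ.1.symm z.1)) _ h
    else Projectivization.mk ℂ (V := TangentSpace 𝓘(ℂ, E) (φ.1.symm z.1)) (A.symm (1, z.2))
      (fun h0 => one_ne_zero (congrArg Prod.fst ((map_eq_zero_iff A.symm A.symm.injective).1 h0)))

lemma vec_ofCoord (φ φ' : atlas E M) (A : E ≃L[ℂ] ℂ × AffineModel E)
    (z : E × AffineModel E) (hz : z.1 ∈ φ.1.target) (hz' : φ.1.symm z.1 ∈ φ'.1.source) :
    ∃ a : ℂ, a ≠ 0 ∧ vec φ' (ofCoord φ A z) =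
      a • cc φ φ' (φ.1.symm z.1) (A.symm (1, z.2)) := by
  have h0 : A.symm (1, z.2) ≠ 0 := fun h0 =>
    one_ne_zero (congrArg Prod.fst ((map_eq_zero_iff A.symm A.symm.injective).1 h0))
  have hs : φ.1.symm z.1 ∈ φ.1.source := φ.1.map_target hz
  have hs' : φ.1.symm z.1 ∈ (achart E (φ.1.symm z.1)).1.source := mem_chart_source E _
  have h : cc φ (achart E (φ.1.symm z.1)) (φ.1.symm z.1) (A.symm (1, z.2)) ≠ 0 :=
    cc_ne_zero _ _ hs hs' h0
  obtain ⟨a, ha, h2⟩ := vec_mk φ' (φ.1.symm z.1) _ h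
  refine ⟨a, ha, ?_⟩
  rw [cc_comp _ _ _ hs hs' hz'] at h2
  rw [← h2, ofCoord, dif_pos h]

lemma ofCoord_eq (φ : atlas E M) (A : E ≃L[ℂ] ℂ × AffineModel E) (z : E × AffineModel E) (x : M)
    (hx : φ.1.symm z.1 = x) (w : TangentSpace 𝓘(ℂ, E) x) (hw : w ≠ 0) (b : ℂ) (hb : b ≠ 0)
    (h : cc φ (achart E x) x (A.symm (1, z.2)) = (b • w : TangentSpace 𝓘(ℂ, E) x)) :
    ofCoord φ A z = ⟨x, Projectivization.mk ℂ w hw⟩ := by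
  subst hx
  have h1 : cc φ (achart E (φ.1.symm z.1)) (φ.1.symm z.1) (A.symm (1, z.2)) ≠ 0 := by
    rw [h]; exact smul_ne_zero hb hw
  rw [ofCoord, dif_pos h1]
  congr 1
  exact (Projectivization.mk_eq_mk_iff' ℂ _ _ _ _).2 ⟨b, h.symm⟩

/-- The standard chart of `ℙ T(M)` attached to a chart `φ` of `M` and linear coordinates
`A : E ≃ ℂ × ℂ^(n-1)`: base point read in `φ`, and affine coordinate of the line. -/
noncomputable def chart (φ : atlas E M) (A : E ≃L[ℂ] ℂ × AffineModel E) :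
    PartialEquiv (ProjTangentBundle E M) (E × AffineModel E) where
  toFun p := (φ.1 p.base, affineCoord A (vec φ p))
  invFun := ofCoord φ A
  source := {p | p.base ∈ φ.1.source ∧ (A (vec φ p)).1 ≠ 0}
  target := φ.1.target ×ˢ Set.univ
  map_source' p hp := ⟨φ.1.map_source hp.1, trivial⟩
  map_target' z hz := by
    have hs := φ.1.map_target hz.1
    refine ⟨hs, ?_⟩
    obtain ⟨a, ha, h⟩ := vec_ofCoord φ φ A z hz.1 hs
    rw [h, cc_self φ hs]
    simpa using ha
  left_inv' := by
    rintro ⟨x, l⟩ ⟨hx, hl⟩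
    have e : φ.1.symm (φ.1 x) = x := φ.1.left_inv hx
    induction l using Projectivization.ind with
    | h w hw =>
    obtain ⟨a, ha, h⟩ := vec_mk φ x w hw
    simp only [h, affineCoord_smul A _ ha] at hl ⊢
    have hl' : (A (cc (achart E x) φ x w)).1 ≠ 0 := by
      intro h0
      apply hl
      rw [map_smul, Prod.smul_fst, h0, smul_zero]
    refine ofCoord_eq φ A _ x e w hw _ (inv_ne_zero hl') ?_
    have h3 : A.symm (1, affineCoord A (cc (achart E x) φ x w)) =
        (A (cc (achart E x) φ x w)).1⁻¹ • cc (achart E x) φ x w := by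
      apply A.injective
      rw [A.apply_symm_apply, map_smul]
      exact Prod.ext (inv_mul_cancel₀ hl').symm rfl
    change cc φ (achart E x) x (A.symm (1, affineCoord A (cc (achart E x) φ x w))) = _
    rw [h3, map_smul]
    exact congrArg _ ((cc_comp (achart E x) φ (achart E x) (mem_chart_source E x) hx
      (mem_chart_source E x) w).trans (cc_self (achart E x) (mem_chart_source E x) w))
  right_inv' := by
    rintro ⟨y, h⟩ hz
    have hs := φ.1.map_target hz.1
    obtain ⟨a, ha, h'⟩ := vec_ofCoord φ φ A _ hz.1 hs
    rw [h', affineCoord_smul A _ ha, cc_self φ hs]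
    exact Prod.ext (φ.1.right_inv hz.1) (by simp [affineCoord])

/-- The explicit formula for the transition maps between two standard charts. -/
noncomputable def trans (φ φ' : atlas E M) (A A' : E ≃L[ℂ] ℂ × AffineModel E)
    (z : E × AffineModel E) : E × AffineModel E :=
  (φ'.1 (φ.1.symm z.1),
    affineCoord A' (cc φ φ' (φ.1.symm z.1) (A.symm (1, z.2))))

lemma chart_trans_apply (φ φ' : atlas E M) (A A' : E ≃L[ℂ] ℂ × AffineModel E)
    {z : E × AffineModel E} (hz : z.1 ∈ φ.1.target) (hz' : φ.1.symm z.1 ∈ φ'.1.source) :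
    chart φ' A' (ofCoord φ A z) = trans φ φ' A A' z := by
  obtain ⟨a, ha, h⟩ := vec_ofCoord φ φ' A z hz hz'
  change (φ'.1 (φ.1.symm z.1), affineCoord A' (vec φ' (ofCoord φ A z))) = _
  rw [h, affineCoord_smul A' _ ha]
  rfl

lemma chart_trans_source (φ φ' : atlas E M) (A A' : E ≃L[ℂ] ℂ × AffineModel E) :
    ((chart φ A).symm.trans (chart φ' A')).source =
      {z | z.1 ∈ (φ.1.symm.trans φ'.1).source ∧
        (A' (cc φ φ' (φ.1.symm z.1) (A.symm (1, z.2)))).1 ≠ 0} := by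
  ext z
  have key : z.1 ∈ φ.1.target → φ.1.symm z.1 ∈ φ'.1.source →
      ((A' (vec φ' (ofCoord φ A z))).1 ≠ 0 ↔
        (A' (cc φ φ' (φ.1.symm z.1) (A.symm (1, z.2)))).1 ≠ 0) := by
    intro hz hz'
    obtain ⟨a, ha, h⟩ := vec_ofCoord φ φ' A z hz hz'
    rw [h, map_smul, Prod.smul_fst, smul_ne_zero_iff]
    simp [ha]
  have e : z ∈ ((chart φ A).symm.trans (chart φ' A')).source ↔
      (z.1 ∈ φ.1.target ∧ True) ∧ (φ.1.symm z.1 ∈ φ'.1.source ∧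
        (A' (vec φ' (ofCoord φ A z))).1 ≠ 0) := Iff.rfl
  rw [e]
  simp only [OpenPartialHomeomorph.trans_source, OpenPartialHomeomorph.symm_source,
    Set.mem_ofPred_eq, Set.mem_inter_iff, Set.mem_preimage]
  constructor
  · rintro ⟨⟨h1, -⟩, h2, h3⟩
    exact ⟨⟨h1, h2⟩, (key h1 h2).1 h3⟩
  · rintro ⟨⟨h1, h2⟩, h3⟩
    exact ⟨⟨h1, trivial⟩, h2, (key h1 h2).2 h3⟩

lemma contDiffOn_cc (φ φ' : atlas E M) (A : E ≃L[ℂ] ℂ × AffineModel E) :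
    ContDiffOn ℂ ω (fun z : E × AffineModel E => cc φ φ' (φ.1.symm z.1) (A.symm (1, z.2)))
      {z | z.1 ∈ (φ.1.symm.trans φ'.1).source} := by
  have h0 := contDiffOn_fderiv_coord_change (n := ω) (I := 𝓘(ℂ, E)) φ φ'
  have h1 : ContDiffOn ℂ ω (fun z : E × AffineModel E =>
      fderivWithin ℂ (φ'.1.extend 𝓘(ℂ, E) ∘ (φ.1.extend 𝓘(ℂ, E)).symm)
        (Set.range 𝓘(ℂ, E)) z.1) {z | z.1 ∈ (φ.1.symm.trans φ'.1).source} := by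
    refine h0.comp contDiff_fst.contDiffOn ?_
    intro z hz
    simpa [OpenPartialHomeomorph.trans_source] using hz
  have h2 : ContDiff ℂ ω (fun z : E × AffineModel E => A.symm ((1 : ℂ), z.2)) :=
    A.symm.contDiff.comp (contDiff_const.prodMk contDiff_snd)
  refine (h1.clm_apply h2.contDiffOn).congr ?_
  intro z hz
  have hz1 : z.1 ∈ φ.1.target := hz.1
  simp [cc, φ.1.right_inv hz1]

lemma chart_trans_isOpen (φ φ' : atlas E M) (A A' : E ≃L[ℂ] ℂ × AffineModel E) :
    IsOpen ((chart φ A).symm.trans (chart φ' A')).source := by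
  rw [chart_trans_source]
  have ho : IsOpen {z : E × AffineModel E | z.1 ∈ (φ.1.symm.trans φ'.1).source} :=
    (φ.1.symm.trans φ'.1).open_source.preimage continuous_fst
  have hc : ContinuousOn (fun z : E × AffineModel E =>
      (A' (cc φ φ' (φ.1.symm z.1) (A.symm (1, z.2)))).1)
      {z | z.1 ∈ (φ.1.symm.trans φ'.1).source} :=
    (continuous_fst.comp A'.continuous).comp_continuousOn (contDiffOn_cc φ φ' A).continuousOn
  exact hc.isOpen_inter_preimage ho isOpen_compl_singleton

lemma contDiffOn_chart_trans (φ φ' : atlas E M) (A A' : E ≃L[ℂ] ℂ × AffineModel E) :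
    ContDiffOn ℂ ω ((chart φ A).symm.trans (chart φ' A'))
      ((chart φ A).symm.trans (chart φ' A')).source := by
  have hs := chart_trans_source φ φ' A A'
  have h : ContDiffOn ℂ ω (trans φ φ' A A') ((chart φ A).symm.trans (chart φ' A')).source := by
    rw [hs]
    have h1 : ContDiffOn ℂ ω (φ'.1 ∘ φ.1.symm) (φ.1.symm.trans φ'.1).source :=
      (contDiffGroupoid ω 𝓘(ℂ, E)).compatible φ.2 φ'.2 |>.1 |> fun h => by
        simpa [contDiffPregroupoid] using h
    have h2 := A'.contDiff (n := ω).comp_contDiffOn (contDiffOn_cc φ φ' A)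
    have h3 := h2.mono (t := {z : E × AffineModel E | z.1 ∈ (φ.1.symm.trans φ'.1).source ∧
        (A' (cc φ φ' (φ.1.symm z.1) (A.symm (1, z.2)))).1 ≠ 0}) fun z hz => hz.1
    refine ContDiffOn.prodMk (h1.comp contDiff_fst.contDiffOn fun z hz => hz.1) ?_
    exact ((contDiff_fst.comp_contDiffOn h3).inv fun z hz => hz.2).smul
      (contDiff_snd.comp_contDiffOn h3)
  refine h.congr fun z hz => ?_
  rw [hs] at hz
  exact chart_trans_apply φ φ' A A' hz.1.1 hz.1.2

variable [FiniteDimensional ℂ E]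

/-- A nonzero vector is nonzero in the homogenizing coordinate of some linear coordinates. -/
lemma exists_affine (v : E) (hv : v ≠ 0) : ∃ A : E ≃L[ℂ] ℂ × AffineModel E, (A v).1 ≠ 0 := by
  have : Nontrivial E := ⟨v, 0, hv⟩
  have hpos : 0 < Module.finrank ℂ E := Module.finrank_pos
  have hd : Module.finrank ℂ E = Module.finrank ℂ (ℂ × AffineModel E) := by
    simp [AffineModel]; omega
  obtain ⟨B⟩ : Nonempty (E ≃L[ℂ] ℂ × AffineModel E) :=
    FiniteDimensional.nonempty_continuousLinearEquiv_of_finrank_eq hd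
  have hB : B.symm (1, 0) ≠ 0 := fun h0 =>
    one_ne_zero (congrArg Prod.fst ((map_eq_zero_iff B.symm B.symm.injective).1 h0))
  obtain ⟨C, hC⟩ := SeparatingDual.exists_continuousLinearEquiv_apply_eq (R := ℂ) hv hB
  exact ⟨C.trans B, by simp [hC]⟩

/-- The atlas of standard charts, all of whose transition maps are holomorphic. -/
noncomputable def core : ChartedSpaceCore (E × AffineModel E) (ProjTangentBundle E M) where
  atlas := {e | ∃ φ A, e = chart φ A}
  chartAt p := chart (achart E p.base)
    (exists_affine (vec (achart E p.base) p) (cc_ne_zero _ _ (mem_chart_source E p.base)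
      (mem_chart_source E p.base) p.line.rep_nonzero)).choose
  mem_chart_source p := ⟨mem_chart_source E p.base,
    (exists_affine (vec (achart E p.base) p) (cc_ne_zero _ _ (mem_chart_source E p.base)
      (mem_chart_source E p.base) p.line.rep_nonzero)).choose_spec⟩
  chart_mem_atlas p := ⟨_, _, rfl⟩
  open_source := by
    rintro _ _ ⟨φ, A, rfl⟩ ⟨φ', A', rfl⟩
    exact chart_trans_isOpen φ φ' A A'
  continuousOn_toFun := by
    rintro _ _ ⟨φ, A, rfl⟩ ⟨φ', A', rfl⟩
    exact (contDiffOn_chart_trans φ φ' A A').continuousOn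

noncomputable instance instTopologicalSpace : TopologicalSpace (ProjTangentBundle E M) :=
  (core (E := E) (M := M)).toTopologicalSpace

noncomputable instance instChartedSpace : ChartedSpace (E × AffineModel E) (ProjTangentBundle E M) :=
  (core (E := E) (M := M)).toChartedSpace

/-- `ℙ T(M)` is a complex manifold. -/
instance instIsManifold : IsManifold 𝓘(ℂ, E × AffineModel E) ω (ProjTangentBundle E M) := by
  refine isManifold_of_contDiffOn _ _ _ ?_
  intro e e' he he'
  obtain ⟨_, ⟨φ, A, rfl⟩, rfl⟩ : ∃ f, ∃ h : f ∈ (core (E := E) (M := M)).atlas,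
      e = (core (E := E) (M := M)).openPartialHomeomorph f h := by
    simpa [atlas, ChartedSpace.atlas] using he
  obtain ⟨_, ⟨φ', A', rfl⟩, rfl⟩ : ∃ f, ∃ h : f ∈ (core (E := E) (M := M)).atlas,
      e' = (core (E := E) (M := M)).openPartialHomeomorph f h := by
    simpa [atlas, ChartedSpace.atlas] using he'
  simp only [modelWithCornersSelf_coe, modelWithCornersSelf_coe_symm, Function.comp_id,
    Function.id_comp, Set.preimage_id, Set.range_id, Set.inter_univ]
  exact contDiffOn_chart_trans φ φ' A A'

/-- The projection `T(M) ∖ 0 → ℙ T(M)`, `v ↦ ℂ v`, extended to the zero section by an arbitrary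
value `p`. (`p` plays no role in what follows: only the germ at a nonzero vector is used.) -/
noncomputable def ofVector (p : ProjTangentBundle E M) (v : TangentBundle 𝓘(ℂ, E) M) :
    ProjTangentBundle E M :=
  haveI := Classical.dec
  if h : v.2 ≠ 0 then ⟨v.1, Projectivization.mk ℂ v.2 h⟩ else p

end
end ProjTangentBundle

open ProjTangentBundle

section Coframes

variable {E M V : Type*} [NormedAddCommGroup E] [NormedSpace ℂ E]
  [TopologicalSpace M] [ChartedSpace E M] [IsManifold 𝓘(ℂ, E) ω M]
  [NormedAddCommGroup V] [NormedSpace ℂ V]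

/-- A coframe on `M` with values in `V`: a holomorphic `V`-valued 1-form `η` all of whose values
`η_x : T_x(M) → V` are isomorphisms.  Holomorphy is expressed through the function `T(M) → V` that
the 1-form defines. -/
structure Coframe (E M V : Type*) [NormedAddCommGroup E] [NormedSpace ℂ E]
    [TopologicalSpace M] [ChartedSpace E M] [IsManifold 𝓘(ℂ, E) ω M]
    [NormedAddCommGroup V] [NormedSpace ℂ V] where
  toEquiv : ∀ x : M, TangentSpace 𝓘(ℂ, E) x ≃L[ℂ] V
  holomorphic : ContMDiff 𝓘(ℂ, E).tangent 𝓘(ℂ, V) ω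
    fun v : TangentBundle 𝓘(ℂ, E) M => toEquiv v.1 v.2

namespace Coframe

/-- The coframe viewed as a `V`-valued function `μ` on `T(M)`. -/
noncomputable def mu (η : Coframe E M V) (v : TangentBundle 𝓘(ℂ, E) M) : V := η.toEquiv v.1 v.2

/-- The coframe read in the preferred chart at `x`, as a `V`-valued 1-form on `E`. -/
noncomputable def inChart (η : Coframe E M V) (x : M) (y : E) : E [⋀^Fin 1]→L[ℂ] V :=
  ContinuousAlternatingMap.ofSubsingleton ℂ E V (0 : Fin 1)
    ((η.toEquiv ((extChartAt 𝓘(ℂ, E) x).symm y)).toContinuousLinearMap.comp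
      (mfderiv 𝓘(ℂ, E) 𝓘(ℂ, E) (extChartAt 𝓘(ℂ, E) x).symm y))

/-- The exterior derivative `dη` at `x`: the exterior derivative computed in the preferred chart
at `x`, pulled back by the differential of that chart. -/
noncomputable def extDerivAt (η : Coframe E M V) (x : M) : TangentSpace 𝓘(ℂ, E) x [⋀^Fin 2]→L[ℂ] V :=
  (extDeriv (η.inChart x) (extChartAt 𝓘(ℂ, E) x x)).compContinuousLinearMap
    (mfderiv 𝓘(ℂ, E) 𝓘(ℂ, E) (extChartAt 𝓘(ℂ, E) x) x)

/-- The structure function `σ^η`, with values in `Hom(∧² V, V)`, determined by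
`dη = σ^η_♯ (η ∧ η)`; see `structureFunction_spec`. -/
noncomputable def structureFunction (η : Coframe E M V) (x : M) : V [⋀^Fin 2]→ₗ[ℂ] V :=
  (1 / 2 : ℂ) • ((η.extDerivAt x).compContinuousLinearMap
    (η.toEquiv x).symm.toContinuousLinearMap).toAlternatingMap

/-- `dη = σ^η_♯ (η ∧ η)`, where `(η ∧ η)(X, Y) = η(X) ⊗ η(Y) - η(Y) ⊗ η(X)`. -/
theorem structureFunction_spec (η : Coframe E M V) (x : M) (X Y : TangentSpace 𝓘(ℂ, E) x) :
    η.extDerivAt x ![X, Y] = η.structureFunction x ![η.toEquiv x X, η.toEquiv x Y] -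
      η.structureFunction x ![η.toEquiv x Y, η.toEquiv x X] := by
  have h : ∀ X Y : TangentSpace 𝓘(ℂ, E) x, η.structureFunction x ![η.toEquiv x X, η.toEquiv x Y] =
      (1 / 2 : ℂ) • η.extDerivAt x ![X, Y] := by
    intro X Y
    simp only [structureFunction, AlternatingMap.smul_apply]
    congr 1
    change η.extDerivAt x (_ ∘ _) = _
    congr 1
    ext i
    fin_cases i <;> simp
  have h2 : η.extDerivAt x ![Y, X] = - η.extDerivAt x ![X, Y] := by
    have := (η.extDerivAt x).toAlternatingMap.map_swap ![X, Y] (i := 0) (j := 1) (by decide)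
    have e : (![X, Y] ∘ Equiv.swap (0 : Fin 2) 1) = ![Y, X] := by
      ext i
      fin_cases i <;> simp
    rw [e] at this
    exact this
  rw [h, h, h2, smul_neg, sub_neg_eq_add, ← add_smul]
  norm_num

/-- The induced coframe `Ω = (π^* η, dμ)` on the manifold `T(M)`, where `π : T(M) → M`. -/
noncomputable def induced (η : Coframe E M V) (u : TangentBundle 𝓘(ℂ, E) M) :
    TangentSpace 𝓘(ℂ, E).tangent u →L[ℂ] V × V :=
  ((η.toEquiv u.1).toContinuousLinearMap.comp
    (mfderiv 𝓘(ℂ, E).tangent 𝓘(ℂ, E) (fun v : TangentBundle 𝓘(ℂ, E) M => v.1) u)).prod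
    (mfderiv 𝓘(ℂ, E).tangent 𝓘(ℂ, V) η.mu u)

/-- The geodesic flow `γ = μ_♯ D_θ` on `T(M)`, where `D_Ω = (D_θ, D_λ)` is the dual frame of
`Ω = (θ, λ)`: at `u` it is the tangent vector on which `Ω` takes the value `(μ(u), 0)`. -/
noncomputable def geodesicFlow (η : Coframe E M V) (u : TangentBundle 𝓘(ℂ, E) M) :
    TangentSpace 𝓘(ℂ, E).tangent u :=
  (η.induced u).inverse (η.mu u, 0)

end Coframe

end Coframes

section ConeStructures

variable {E M V B : Type*} [NormedAddCommGroup E] [NormedSpace ℂ E] [FiniteDimensional ℂ E]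
  [TopologicalSpace M] [ChartedSpace E M] [IsManifold 𝓘(ℂ, E) ω M]
  [NormedAddCommGroup V] [NormedSpace ℂ V]
  [NormedAddCommGroup B] [NormedSpace ℂ B]

/-- The fibre `C_x ⊆ ℙ T_x(M)`. -/
def fiber (C : Set (ProjTangentBundle E M)) (x : M) : Set (ℙ ℂ (TangentSpace 𝓘(ℂ, E) x)) :=
  {l | ⟨x, l⟩ ∈ C}

/-- The projection `C → M`. -/
def proj (C : Set (ProjTangentBundle E M)) (c : C) : M := c.1.base

/-- `C ⊆ ℙ T(M)`, which comes with a structure of complex manifold on it (modelled on `B`), is a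
cone structure on `M`: it is a complex submanifold of `ℙ T(M)`, and the projection `C → M` is a
submersion with connected fibres. -/
structure IsConeStructure (C : Set (ProjTangentBundle E M)) [ChartedSpace B C]
    [IsManifold 𝓘(ℂ, B) ω C] : Prop where
  submanifold : IsSmoothEmbedding 𝓘(ℂ, B) 𝓘(ℂ, E × AffineModel E) ω
    (Subtype.val : C → ProjTangentBundle E M)
  submersion : IsSubmersion 𝓘(ℂ, B) 𝓘(ℂ, E) ω (proj C)
  connected : ∀ x : M, IsConnected (proj C ⁻¹' {x})

/-- `C` is `Z`-isotrivial: each `C_x ⊆ ℙ T_x(M)` is projectively equivalent to `Z ⊆ ℙ V`. -/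
def IsIsotrivial (Z : Set (ℙ ℂ V)) (C : Set (ProjTangentBundle E M)) : Prop :=
  ∀ x : M, ∃ A : TangentSpace 𝓘(ℂ, E) x ≃ₗ[ℂ] V,
    Projectivization.map A.toLinearMap A.injective '' fiber C x = Z

/-- The coframe `η` is adapted: each `η_x : T_x(M) → V` sends `C_x` to `Z`. -/
def IsAdapted (Z : Set (ℙ ℂ V)) (C : Set (ProjTangentBundle E M)) (η : Coframe E M V) : Prop :=
  ∀ x : M, Projectivization.map (η.toEquiv x).toLinearEquiv.toLinearMap (η.toEquiv x).injective ''
    fiber C x = Z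

variable (C : Set (ProjTangentBundle E M)) [ChartedSpace B C] [IsManifold 𝓘(ℂ, B) ω C]

/-- A distribution on `C`: a linear subspace of each tangent space of the manifold `C`. -/
abbrev Distribution : Type _ := ∀ c : C, Submodule ℂ (TangentSpace 𝓘(ℂ, B) c)

/-- The subbundle `P ⊆ T(C)`, whose fibre at `α ∈ C_x` is the preimage of the affine tangent space
`T̂_α(C_x) ⊆ T_x(M)` under the differential of the projection `C → M`. -/
noncomputable def distributionP : Distribution (B := B) C := fun c =>
  (affineTangentSpace (fiber C (proj C c)) c.1.line).comap
    (mfderiv 𝓘(ℂ, B) 𝓘(ℂ, E) (proj C) c).toLinearMap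

/-- The distribution `Γ ⊆ T(C)` spanned by the image of the geodesic flow `γ` of `η`: at `c ∈ C_x` it
consists of the tangent vectors of `C ⊆ ℙ T(M)` that lie in the span of the images of `γ_u`, `u` a
nonzero vector of `T_x(M)` on the line `c`, under the differential of `T(M) ∖ 0 → ℙ T(M)`.  If `η`
is adapted to `C`, these images are themselves tangent to `C`, and `Γ` is a conic connection. -/
noncomputable def Gamma (η : Coframe E M V) : Distribution (B := B) C := fun c =>
  (Submodule.span ℂ {ξ : TangentSpace 𝓘(ℂ, E × AffineModel E) c.1 |
      ∃ (u : TangentSpace 𝓘(ℂ, E) c.1.base) (hu : u ≠ 0),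
        Projectivization.mk ℂ u hu = c.1.line ∧
        ξ = mfderiv 𝓘(ℂ, E).tangent 𝓘(ℂ, E × AffineModel E) (ofVector c.1)
          (⟨c.1.base, u⟩ : TangentBundle 𝓘(ℂ, E) M) (η.geodesicFlow ⟨c.1.base, u⟩)}).comap
    (mfderiv 𝓘(ℂ, B) 𝓘(ℂ, E × AffineModel E)
      (Subtype.val : C → ProjTangentBundle E M) c).toLinearMap

variable {C}

/-- `v` is, over the open set `U ⊆ C`, a holomorphic section of the distribution `D`. -/
def IsLocalSection (D : Distribution (B := B) C) (U : Set C)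
    (v : ∀ c : C, TangentSpace 𝓘(ℂ, B) c) : Prop :=
  IsOpen U ∧ ContMDiffOn 𝓘(ℂ, B) 𝓘(ℂ, B).tangent ω
    (fun c => (⟨c, v c⟩ : TangentBundle 𝓘(ℂ, B) C)) U ∧ ∀ c ∈ U, v c ∈ D c

/-- The condition for a conic connection `D` to be a characteristic connection: the Lie bracket of
any local section `v` of `P` with any local section `w` of `D` is again a local section of `P`.
(The bracket of holomorphic vector fields is holomorphic, so only its values matter.) -/
def IsCharacteristic (D : Distribution (B := B) C) : Prop :=
  ∀ (U : Set C) (v w : ∀ c : C, TangentSpace 𝓘(ℂ, B) c),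
    IsLocalSection (distributionP C) U v → IsLocalSection D U w →
      ∀ c ∈ U, VectorField.mlieBracket 𝓘(ℂ, B) v w c ∈ distributionP C c

end ConeStructures

end ConicConnections

open ConicConnections

/-!
The statement is local. In coordinates `e` of `M`, an adapted coframe is an invertible matrix
`N(e)`, and it identifies the cone structure `C` with the product of `M` and `Z`: a point of `C` is
a point of `M` together with a line of `Z`, the image of a line of `T_x(M)` under the coframe. Near
a given line spanned by `s`, choose a linear functional `ℓ` with `ℓ(s) = 1`; the slice `ℓ = 1` of
the cone over `Z` has a holomorphic parametrization `g(y)`, and `(e, y)` are coordinates on `C`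
(`exists_adapted_coordinates`). This rests on `C → M` being a submersion and on `C` being a
submanifold of `ℙ T(M)`: the inverse function theorem on `C` yields `g`. Because `g` parametrizes
the whole slice near `s`, the affine tangent space of `Z` at the line of `s` is spanned by `s` and
by the velocities `dg(ν)` (`velocity_eq_of_slice`).

In these coordinates the field `w = (N(e)⁻¹ g(y), 0)` spans `Γ`, for it lies over the tautological
line and, like the geodesic flow, does not move the value of the coframe
(`IsConeStructure.mem_Gamma`). For each `ν` the field `v = (N(e)⁻¹ dg_y(ν), 0)` is a section of `P`.
Both fields are horizontal, so the part of `[v, w]` along `M` is computed by the exterior derivative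
of the coframe: the coframe takes on it the value `2 σ(g(y), dg_y(ν))`
(`Coframe.lieBracket_horizontalField`). If `Γ` is characteristic, then `[v, w]` lies in `P`, that
is, `σ(s, dg(ν))` lies in the affine tangent space (`structureFunction_mem_of_coordinates`). Since
`σ(s, s) = 0`, this covers the whole affine tangent space, which is the condition defining `Ξ_Z`
(`structureFunction_mem_Xi`).
-/

namespace ConicConnections

open ProjTangentBundle VectorField

/-! ### Holomorphic maps into and out of `ℙ T(M)` -/

section TangentVectors

variable {E M : Type*} [NormedAddCommGroup E] [NormedSpace ℂ E]
  [TopologicalSpace M] [ChartedSpace E M]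

/-- The tangent vector of `M` with coordinates `(e, h)` in the preferred chart at `x₀`. -/
noncomputable def localVector (x₀ : M) (z : E × E) : TangentBundle 𝓘(ℂ, E) M :=
  ⟨(extChartAt 𝓘(ℂ, E) x₀).symm z.1,
    mfderiv 𝓘(ℂ, E) 𝓘(ℂ, E) (extChartAt 𝓘(ℂ, E) x₀).symm z.1 z.2⟩

lemma base_ofVector (p : ProjTangentBundle E M) (v : TangentBundle 𝓘(ℂ, E) M) (hv : v.2 ≠ 0) :
    (ofVector p v).base = v.1 := by
  rw [ofVector, dif_pos hv]

variable [IsManifold 𝓘(ℂ, E) ω M]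

lemma contMDiffAt_extChartAt_symm {x₀ : M} {e : E} (he : e ∈ (extChartAt 𝓘(ℂ, E) x₀).target) :
    ContMDiffAt 𝓘(ℂ, E) 𝓘(ℂ, E) ω (extChartAt 𝓘(ℂ, E) x₀).symm e :=
  (contMDiffOn_extChartAt_symm x₀).contMDiffAt ((isOpen_extChartAt_target x₀).mem_nhds he)

/-- As `T_x(M)` is identified with `E` through the preferred chart at `x`, the differential of an
inverse chart is a coordinate change of the tangent bundle. -/
lemma mfderiv_extChartAt_symm_eq_cc {x₀ : M} {e : E} (he : e ∈ (extChartAt 𝓘(ℂ, E) x₀).target) :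
    mfderiv 𝓘(ℂ, E) 𝓘(ℂ, E) (extChartAt 𝓘(ℂ, E) x₀).symm e =
      cc (achart E x₀) (achart E ((extChartAt 𝓘(ℂ, E) x₀).symm e))
        ((extChartAt 𝓘(ℂ, E) x₀).symm e) := by
  have hx : (extChartAt 𝓘(ℂ, E) x₀).symm e ∈ (chartAt E x₀).source := by
    rw [← extChartAt_source 𝓘(ℂ, E)]; exact (extChartAt 𝓘(ℂ, E) x₀).map_target he
  have h1 := TangentBundle.symmL_trivializationAt (I := 𝓘(ℂ, E)) hx
  rw [TangentBundle.symmL_trivializationAt_eq_core hx] at h1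
  simp only [modelWithCornersSelf_coe, Set.range_id, mfderivWithin_univ] at h1
  rw [(extChartAt 𝓘(ℂ, E) x₀).right_inv he] at h1
  exact h1.symm

lemma contMDiffAt_localVector {x₀ : M} {z : E × E}
    (hz : z.1 ∈ (extChartAt 𝓘(ℂ, E) x₀).target) :
    ContMDiffAt 𝓘(ℂ, E × E) 𝓘(ℂ, E).tangent ω (localVector (M := M) x₀) z := by
  have hfst : ContMDiffAt 𝓘(ℂ, E × E) 𝓘(ℂ, E) ω (Prod.fst : E × E → E) z :=
    contDiff_fst.contMDiff.contMDiffAt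
  rw [Bundle.contMDiffAt_totalSpace]
  refine ⟨(contMDiffAt_extChartAt_symm hz).comp z hfst, ?_⟩
  set x₁ := (extChartAt 𝓘(ℂ, E) x₀).symm z.1 with hx₁
  have hsymm : ∀ᶠ e in 𝓝 z.1, e ∈ (extChartAt 𝓘(ℂ, E) x₀).target :=
    (isOpen_extChartAt_target x₀).mem_nhds hz
  have hsrc : ∀ᶠ e in 𝓝 z.1, (extChartAt 𝓘(ℂ, E) x₀).symm e ∈ (chartAt E x₁).source :=
    (contMDiffAt_extChartAt_symm hz).continuousAt
      ((chartAt E x₁).open_source.mem_nhds (mem_chart_source E x₁))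
  -- the transition map between the two charts
  have hf : ContDiffAt ℂ ω (extChartAt 𝓘(ℂ, E) x₁ ∘ (extChartAt 𝓘(ℂ, E) x₀).symm) z.1 := by
    rw [← contMDiffAt_iff_contDiffAt]
    exact ContMDiffAt.comp z.1 (contMDiffAt_extChartAt (x := x₁)) (contMDiffAt_extChartAt_symm hz)
  have hdf : ContDiffAt ℂ ω
      (fun y : E × E =>
        fderiv ℂ (extChartAt 𝓘(ℂ, E) x₁ ∘ (extChartAt 𝓘(ℂ, E) x₀).symm) y.1 y.2) z :=
    ContDiffAt.clm_apply ((hf.fderiv_right (m := ω) le_rfl).comp z contDiffAt_fst) contDiffAt_snd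
  refine hdf.contMDiffAt.congr_of_eventuallyEq ?_
  filter_upwards [continuousAt_fst.eventually hsymm, continuousAt_fst.eventually hsrc] with y hy hy'
  have h1 := TangentBundle.continuousLinearMapAt_trivializationAt (I := 𝓘(ℂ, E)) hy'
  have h2 : mfderiv 𝓘(ℂ, E) 𝓘(ℂ, E) (extChartAt 𝓘(ℂ, E) x₁ ∘ (extChartAt 𝓘(ℂ, E) x₀).symm) y.1 =
      (mfderiv 𝓘(ℂ, E) 𝓘(ℂ, E) (extChartAt 𝓘(ℂ, E) x₁) ((extChartAt 𝓘(ℂ, E) x₀).symm y.1)).comp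
        (mfderiv 𝓘(ℂ, E) 𝓘(ℂ, E) (extChartAt 𝓘(ℂ, E) x₀).symm y.1) :=
    mfderiv_comp y.1 (mdifferentiableAt_extChartAt hy')
      ((contMDiffAt_extChartAt_symm hy).mdifferentiableAt (by simp))
  rw [mfderiv_eq_fderiv] at h2
  have h3 : fderiv ℂ (extChartAt 𝓘(ℂ, E) x₁ ∘ (extChartAt 𝓘(ℂ, E) x₀).symm) y.1 y.2 =
      (trivializationAt E (TangentSpace 𝓘(ℂ, E)) x₁).continuousLinearMapAt ℂ
        ((extChartAt 𝓘(ℂ, E) x₀).symm y.1) (localVector x₀ y).2 :=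
    (congrArg (fun L : E →L[ℂ] E => L y.2) h2).trans
      (congrArg (fun L : E →L[ℂ] E => L (localVector x₀ y).2) h1.symm)
  exact (h3.trans
    (Bundle.Trivialization.continuousLinearMapAt_apply_of_mem (R := ℂ) _ (by exact hy') _)).symm

/-- The base point `x₀` of the trivialization is kept apart from `u.1`, so that the lemma applies
when the two are only propositionally equal. -/
lemma contMDiffAt_trivializationAt_snd {x₀ : M} {u : TangentBundle 𝓘(ℂ, E) M} (h : x₀ = u.1) :
    ContMDiffAt 𝓘(ℂ, E).tangent 𝓘(ℂ, E) ω
      (fun v : TangentBundle 𝓘(ℂ, E) M =>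
        (trivializationAt E (TangentSpace 𝓘(ℂ, E)) x₀ v).2) u := by
  subst h
  exact (Bundle.contMDiffAt_totalSpace.1 (contMDiffAt_id (x := u))).2

lemma eventually_snd_ne_zero (v : TangentBundle 𝓘(ℂ, E) M) (hv : v.2 ≠ 0) :
    ∀ᶠ u in 𝓝 v, u.2 ≠ 0 := by
  have h : (trivializationAt E (TangentSpace 𝓘(ℂ, E)) v.1 v).2 ≠ 0 :=
    cc_ne_zero (achart E v.1) (achart E v.1) (mem_chart_source E v.1) (mem_chart_source E v.1) hv
  filter_upwards [(contMDiffAt_trivializationAt_snd (u := v) rfl).continuousAt.eventually_ne h]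
    with u hu hu0
  refine hu ?_
  change cc (achart E u.1) (achart E v.1) u.1 u.2 = 0
  rw [hu0]
  exact map_zero _

/-- Bundle-theoretic coordinates and `ℙ T(M)`-coordinates of a nonzero vector agree. -/
lemma vec_ofVector (p : ProjTangentBundle E M) (x₀ : M) (v : TangentBundle 𝓘(ℂ, E) M)
    (hv : v.2 ≠ 0) : ∃ a : ℂ, a ≠ 0 ∧ vec (achart E x₀) (ofVector p v) =
      a • (trivializationAt E (TangentSpace 𝓘(ℂ, E)) x₀ v).2 := by
  rw [ofVector, dif_pos hv]
  exact vec_mk (achart E x₀) v.1 v.2 hv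

lemma contDiffAt_affineCoord (A : E ≃L[ℂ] ℂ × AffineModel E) {h : E} (hh : (A h).1 ≠ 0) :
    ContDiffAt ℂ ω (affineCoord A) h := by
  have hA : ContDiffAt ℂ ω A h := A.contDiff.contDiffAt
  exact (ContDiffAt.inv (contDiff_fst.contDiffAt.comp h hA) hh).smul
    (contDiff_snd.contDiffAt.comp h hA)

end TangentVectors

section ProjTangent

variable {E M : Type*} [NormedAddCommGroup E] [NormedSpace ℂ E] [FiniteDimensional ℂ E]
  [TopologicalSpace M] [ChartedSpace E M] [IsManifold 𝓘(ℂ, E) ω M]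

/-- The linear coordinates on `E` used by the preferred chart of `ℙ T(M)` at `p`. -/
noncomputable def preferredAffine (p : ProjTangentBundle E M) : E ≃L[ℂ] ℂ × AffineModel E :=
  (exists_affine (vec (achart E p.base) p) (cc_ne_zero _ _ (mem_chart_source E p.base)
    (mem_chart_source E p.base) p.line.rep_nonzero)).choose

lemma extChartAt_projTangent (p : ProjTangentBundle E M) :
    extChartAt 𝓘(ℂ, E × AffineModel E) p = chart (achart E p.base) (preferredAffine p) := by
  simp only [extChartAt, OpenPartialHomeomorph.extend, modelWithCornersSelf_partialEquiv,
    PartialEquiv.trans_refl]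
  rfl

lemma extChartAt_projTangent_source_mem (p : ProjTangentBundle E M) :
    (chart (achart E p.base) (preferredAffine p)).source ∈ 𝓝 p := by
  rw [← extChartAt_projTangent]
  exact extChartAt_source_mem_nhds p

theorem contMDiffAt_base (p : ProjTangentBundle E M) :
    ContMDiffAt 𝓘(ℂ, E × AffineModel E) 𝓘(ℂ, E) ω
      (ProjTangentBundle.base : ProjTangentBundle E M → M) p := by
  have h1 : ContMDiffAt 𝓘(ℂ, E × AffineModel E) 𝓘(ℂ, E) ω
      (fun q => (extChartAt 𝓘(ℂ, E) p.base).symm (extChartAt 𝓘(ℂ, E × AffineModel E) p q).1) p := by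
    refine ContMDiffAt.comp p
      (g := fun z : E × AffineModel E => (extChartAt 𝓘(ℂ, E) p.base).symm z.1) ?_
      (contMDiffAt_extChartAt (x := p))
    refine ContMDiffAt.comp _ (contMDiffAt_extChartAt_symm ?_) contDiff_fst.contMDiff.contMDiffAt
    rw [extChartAt_projTangent]
    exact mem_extChartAt_target (I := 𝓘(ℂ, E)) p.base
  refine h1.congr_of_eventuallyEq ?_
  filter_upwards [extChartAt_projTangent_source_mem p] with q hq
  rw [extChartAt_projTangent]
  exact ((chartAt E p.base).left_inv hq.1).symm

theorem contMDiffAt_ofVector (p : ProjTangentBundle E M) (u : TangentBundle 𝓘(ℂ, E) M)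
    (hu : u.2 ≠ 0) :
    ContMDiffAt 𝓘(ℂ, E).tangent 𝓘(ℂ, E × AffineModel E) ω (ofVector p) u := by
  set q := ofVector p u with hq
  have hbase : q.base = u.1 := base_ofVector p u hu
  set A := preferredAffine q with hA
  set t : TangentBundle 𝓘(ℂ, E) M → E :=
    fun v => (trivializationAt E (TangentSpace 𝓘(ℂ, E)) q.base v).2 with ht
  have htu : ContMDiffAt 𝓘(ℂ, E).tangent 𝓘(ℂ, E) ω t u := contMDiffAt_trivializationAt_snd hbase
  have hmem : q ∈ (chart (achart E q.base) A).source :=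
    mem_of_mem_nhds (extChartAt_projTangent_source_mem q)
  have hAu : (A (t u)).1 ≠ 0 := by
    obtain ⟨a, ha, h⟩ := vec_ofVector p q.base u hu
    have h2 := hmem.2
    rw [hq, ← hq, h, map_smul, Prod.smul_fst] at h2
    exact right_ne_zero_of_smul h2
  have hproj : ContMDiffAt 𝓘(ℂ, E).tangent 𝓘(ℂ, E) ω
      (fun v : TangentBundle 𝓘(ℂ, E) M => extChartAt 𝓘(ℂ, E) q.base v.1) u := by
    refine ContMDiffAt.comp u (contMDiffAt_extChartAt' ?_)
      (Bundle.contMDiff_proj (TangentSpace 𝓘(ℂ, E))).contMDiffAt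
    rw [← hbase]
    exact mem_chart_source E q.base
  have hk : ContMDiffAt 𝓘(ℂ, E).tangent 𝓘(ℂ, E × AffineModel E) ω
      (fun v => (extChartAt 𝓘(ℂ, E) q.base v.1, affineCoord A (t v))) u :=
    hproj.prodMk_space ((contDiffAt_affineCoord A hAu).contMDiffAt.comp u htu)
  have hev : ∀ᶠ v in 𝓝 u, ofVector p v ∈ (chart (achart E q.base) A).source ∧
      chart (achart E q.base) A (ofVector p v) =
        (extChartAt 𝓘(ℂ, E) q.base v.1, affineCoord A (t v)) := by
    have h1 : ∀ᶠ v in 𝓝 u, v.1 ∈ (chartAt E q.base).source := by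
      refine (Bundle.contMDiff_proj (TangentSpace 𝓘(ℂ, E)) (IB := 𝓘(ℂ, E))
        (n := ω)).continuous.continuousAt ((chartAt E q.base).open_source.mem_nhds ?_)
      rw [← hbase]
      exact mem_chart_source E q.base
    have h2 : ∀ᶠ v in 𝓝 u, (A (t v)).1 ≠ 0 :=
      ((continuous_fst.comp A.continuous).continuousAt.comp htu.continuousAt).eventually_ne hAu
    filter_upwards [h1, h2, eventually_snd_ne_zero u hu] with v hv1 hv2 hv3
    obtain ⟨a, ha, h⟩ := vec_ofVector p q.base v hv3
    refine ⟨⟨by rw [base_ofVector p v hv3]; exact hv1, ?_⟩, ?_⟩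
    · rw [h, map_smul, Prod.smul_fst]
      exact smul_ne_zero ha hv2
    · change ((chartAt E q.base) (ofVector p v).base, affineCoord A (vec _ (ofVector p v))) = _
      rw [h, affineCoord_smul A _ ha, base_ofVector p v hv3]
      rfl
  have hsymm : ContMDiffAt 𝓘(ℂ, E × AffineModel E) 𝓘(ℂ, E × AffineModel E) ω
      (extChartAt 𝓘(ℂ, E × AffineModel E) q).symm
      (extChartAt 𝓘(ℂ, E) q.base u.1, affineCoord A (t u)) := by
    rw [← hev.self_of_nhds.2, ← extChartAt_projTangent]
    exact contMDiffAt_extChartAt_symm (mem_extChartAt_target q)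
  refine (ContMDiffAt.comp u hsymm hk).congr_of_eventuallyEq ?_
  filter_upwards [hev] with v hv
  rw [Function.comp_apply, ← hv.2, extChartAt_projTangent]
  exact ((chart (achart E q.base) A).left_inv hv.1).symm

/-- Near each point, the tautological line bundle over `ℙ T(M)` has a nowhere vanishing holomorphic
section. -/
theorem exists_local_lift (p : ProjTangentBundle E M) :
    ∃ T : ProjTangentBundle E M → TangentBundle 𝓘(ℂ, E) M,
      ContMDiffAt 𝓘(ℂ, E × AffineModel E) 𝓘(ℂ, E).tangent ω T p ∧
      ∀ᶠ q in 𝓝 p, (T q).2 ≠ 0 ∧ ofVector p (T q) = q := by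
  set A := preferredAffine p
  set k := extChartAt 𝓘(ℂ, E × AffineModel E) p with hk
  have hkA : k = chart (achart E p.base) A := extChartAt_projTangent p
  have htarget : ∀ q ∈ k.source, (k q).1 ∈ (extChartAt 𝓘(ℂ, E) p.base).target := by
    intro q hq
    rw [hkA] at hq ⊢
    exact (extChartAt 𝓘(ℂ, E) p.base).map_source (by rw [extChartAt_source]; exact hq.1)
  refine ⟨fun q => localVector p.base ((k q).1, A.symm (1, (k q).2)), ?_, ?_⟩
  · refine ContMDiffAt.comp p (contMDiffAt_localVector (htarget p (mem_extChartAt_source p))) ?_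
    have h : ContDiff ℂ ω (fun z : E × AffineModel E => (z.1, A.symm (1, z.2))) :=
      contDiff_fst.prodMk (A.symm.contDiff.comp (contDiff_const.prodMk contDiff_snd))
    exact ContMDiffAt.comp p h.contMDiff.contMDiffAt contMDiffAt_extChartAt
  · filter_upwards [extChartAt_source_mem_nhds (I := 𝓘(ℂ, E × AffineModel E)) p] with q hq
    have hcc := mfderiv_extChartAt_symm_eq_cc (htarget q hq)
    have hs : (extChartAt 𝓘(ℂ, E) p.base).symm (k q).1 ∈ (achart E p.base).1.source := by
      rw [coe_achart, ← extChartAt_source 𝓘(ℂ, E)]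
      exact (extChartAt 𝓘(ℂ, E) p.base).map_target (htarget q hq)
    have h0 : A.symm (1, (k q).2) ≠ 0 := fun h0 =>
      one_ne_zero (congrArg Prod.fst ((map_eq_zero_iff A.symm A.symm.injective).1 h0))
    have hvec : (localVector p.base ((k q).1, A.symm (1, (k q).2))).2 =
        cc (achart E p.base) (achart E ((extChartAt 𝓘(ℂ, E) p.base).symm (k q).1))
          ((extChartAt 𝓘(ℂ, E) p.base).symm (k q).1) (A.symm (1, (k q).2)) :=
      congrArg (fun L : E →L[ℂ] E => L (A.symm (1, (k q).2))) hcc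
    have hne : (localVector p.base ((k q).1, A.symm (1, (k q).2))).2 ≠ 0 := by
      rw [hvec]
      exact cc_ne_zero _ _ hs (mem_chart_source E _) h0
    refine ⟨hne, ?_⟩
    rw [ofVector, dif_pos hne]
    have h1 : ofCoord (achart E p.base) A (k q) = q := by
      have := (chart (achart E p.base) A).left_inv (x := q) (by rw [← hkA]; exact hq)
      rw [← hkA] at this
      exact this
    refine Eq.trans ?_ h1
    symm
    exact ofCoord_eq _ _ _ _ rfl _ hne 1 one_ne_zero
      (hvec.symm.trans (one_smul ℂ (localVector p.base ((k q).1, A.symm (1, (k q).2))).2).symm)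

end ProjTangent

/-! ### Coframes in coordinates and the geodesic flow -/

namespace Coframe

variable {E M V : Type*} [NormedAddCommGroup E] [NormedSpace ℂ E]
  [TopologicalSpace M] [ChartedSpace E M] [IsManifold 𝓘(ℂ, E) ω M]
  [NormedAddCommGroup V] [NormedSpace ℂ V]

/-- The coframe read in the preferred chart at `x₀`, as a function with values in the linear maps
`E → V`. -/
noncomputable def coord (η : Coframe E M V) (x₀ : M) (e : E) : E →L[ℂ] V :=
  (η.toEquiv ((extChartAt 𝓘(ℂ, E) x₀).symm e)).toContinuousLinearMap.comp
    (mfderiv 𝓘(ℂ, E) 𝓘(ℂ, E) (extChartAt 𝓘(ℂ, E) x₀).symm e)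

lemma coord_apply (η : Coframe E M V) (x₀ : M) (e h : E) :
    η.coord x₀ e h = η.mu (localVector x₀ (e, h)) := rfl

lemma coord_isInvertible (η : Coframe E M V) {x₀ : M} {e : E}
    (he : e ∈ (extChartAt 𝓘(ℂ, E) x₀).target) : (η.coord x₀ e).IsInvertible := by
  have h := isInvertible_mfderivWithin_extChartAt_symm (I := 𝓘(ℂ, E)) (x := x₀) he
  simp only [modelWithCornersSelf_coe, Set.range_id, mfderivWithin_univ] at h
  exact ContinuousLinearMap.isInvertible_equiv.comp h

lemma contDiffOn_coord [FiniteDimensional ℂ E] (η : Coframe E M V) (x₀ : M) :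
    ContDiffOn ℂ ω (η.coord x₀) (extChartAt 𝓘(ℂ, E) x₀).target := by
  rw [contDiffOn_clm_apply]
  intro h e he
  refine ContDiffAt.contDiffWithinAt ?_
  rw [← contMDiffAt_iff_contDiffAt]
  refine ContMDiffAt.comp e (f := fun y => localVector x₀ (y, h))
    (η.holomorphic.contMDiffAt (x := localVector x₀ (e, h))) ?_
  exact ContMDiffAt.comp e (f := fun y : E => (y, h)) (contMDiffAt_localVector he)
    (contDiff_id.prodMk contDiff_const).contMDiff.contMDiffAt

lemma contDiffAt_coord [FiniteDimensional ℂ E] (η : Coframe E M V) {x₀ : M} {e : E}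
    (he : e ∈ (extChartAt 𝓘(ℂ, E) x₀).target) : ContDiffAt ℂ ω (η.coord x₀) e :=
  (η.contDiffOn_coord x₀).contDiffAt ((isOpen_extChartAt_target x₀).mem_nhds he)

/-- At a point `x` of the chart domain at `x₀`, the inverse of the coframe in coordinates is the
inverse of the coframe followed by the differential of the chart. -/
lemma coord_inverse_apply (η : Coframe E M V) {x₀ x : M} (hx : x ∈ (extChartAt 𝓘(ℂ, E) x₀).source)
    (v : V) : (η.coord x₀ (extChartAt 𝓘(ℂ, E) x₀ x)).inverse v =
      mfderiv 𝓘(ℂ, E) 𝓘(ℂ, E) (extChartAt 𝓘(ℂ, E) x₀) x ((η.toEquiv x).symm v) := by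
  have hinv := η.coord_isInvertible ((extChartAt 𝓘(ℂ, E) x₀).map_source hx)
  refine (hinv.inverse_apply_eq (y := v)).2 ?_
  have h1 := mfderivWithin_extChartAt_symm_comp_mfderiv_extChartAt' (I := 𝓘(ℂ, E)) hx
  simp only [modelWithCornersSelf_coe, Set.range_id, mfderivWithin_univ] at h1
  have key : ∀ x' : M, x' = x → ∀ z : E, η.toEquiv x' z = η.toEquiv x z := by
    rintro _ rfl _
    rfl
  have h2 : η.coord x₀ (extChartAt 𝓘(ℂ, E) x₀ x)
      (mfderiv 𝓘(ℂ, E) 𝓘(ℂ, E) (extChartAt 𝓘(ℂ, E) x₀) x ((η.toEquiv x).symm v)) =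
      η.toEquiv x ((η.toEquiv x).symm v) :=
    (congrArg (fun L : E →L[ℂ] E => η.toEquiv ((extChartAt 𝓘(ℂ, E) x₀).symm
      (extChartAt 𝓘(ℂ, E) x₀ x)) (L ((η.toEquiv x).symm v))) h1).trans
      (key _ ((extChartAt 𝓘(ℂ, E) x₀).left_inv hx) _)
  exact (h2.trans ((η.toEquiv x).apply_symm_apply v)).symm

/-- The vector `η_x⁻¹(v) ∈ T_x(M)`, as a function of `(x, v) ∈ M × V`. -/
noncomputable def lift (η : Coframe E M V) (z : M × V) : TangentBundle 𝓘(ℂ, E) M :=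
  ⟨z.1, (η.toEquiv z.1).symm z.2⟩

@[simp] lemma mu_lift (η : Coframe E M V) (z : M × V) : η.mu (η.lift z) = z.2 :=
  (η.toEquiv z.1).apply_symm_apply z.2

@[simp] lemma lift_mu (η : Coframe E M V) (v : TangentBundle 𝓘(ℂ, E) M) :
    η.lift (v.1, η.mu v) = v :=
  congrArg (Bundle.TotalSpace.mk v.1) ((η.toEquiv v.1).symm_apply_apply v.2)

lemma lift_eq_localVector (η : Coframe E M V) {x₀ x : M}
    (hx : x ∈ (extChartAt 𝓘(ℂ, E) x₀).source) (v : V) :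
    η.lift (x, v) = localVector x₀ (extChartAt 𝓘(ℂ, E) x₀ x,
      (η.coord x₀ (extChartAt 𝓘(ℂ, E) x₀ x)).inverse v) := by
  have h1 : (η.mu (localVector x₀ (extChartAt 𝓘(ℂ, E) x₀ x,
      (η.coord x₀ (extChartAt 𝓘(ℂ, E) x₀ x)).inverse v))) = v := by
    rw [← coord_apply]
    exact (η.coord_isInvertible ((extChartAt 𝓘(ℂ, E) x₀).map_source hx)).self_apply_inverse v
  rw [← η.lift_mu (localVector _ _), h1]
  exact congrArg (fun y => η.lift (y, v)) ((extChartAt 𝓘(ℂ, E) x₀).left_inv hx).symm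

variable [FiniteDimensional ℂ E]

lemma contDiffAt_inverse_coord (η : Coframe E M V) {x₀ : M} {e : E}
    (he : e ∈ (extChartAt 𝓘(ℂ, E) x₀).target) :
    ContDiffAt ℂ ω (fun y => (η.coord x₀ y).inverse) e := by
  have : CompleteSpace E := FiniteDimensional.complete ℂ E
  exact ((η.coord_isInvertible he).contDiffAt_map_inverse).comp e (η.contDiffAt_coord he)

lemma contMDiff_lift (η : Coframe E M V) :
    ContMDiff (𝓘(ℂ, E).prod 𝓘(ℂ, V)) 𝓘(ℂ, E).tangent ω η.lift := by
  intro z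
  set x₀ := z.1 with hx₀
  have hfst : ContMDiffAt (𝓘(ℂ, E).prod 𝓘(ℂ, V)) 𝓘(ℂ, E) ω
      (fun y : M × V => extChartAt 𝓘(ℂ, E) x₀ y.1) z :=
    ContMDiffAt.comp z (contMDiffAt_extChartAt (x := x₀)) contMDiffAt_fst
  have hinv : ContMDiffAt (𝓘(ℂ, E).prod 𝓘(ℂ, V)) 𝓘(ℂ, V →L[ℂ] E) ω
      (fun y : M × V => (η.coord x₀ (extChartAt 𝓘(ℂ, E) x₀ y.1)).inverse) z :=
    ContMDiffAt.comp z (g := fun e => (η.coord x₀ e).inverse)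
      (η.contDiffAt_inverse_coord (mem_extChartAt_target x₀)).contMDiffAt hfst
  have h := ContMDiffAt.comp z (contMDiffAt_localVector (M := M) (x₀ := x₀)
    (z := (extChartAt 𝓘(ℂ, E) x₀ z.1, (η.coord x₀ (extChartAt 𝓘(ℂ, E) x₀ z.1)).inverse z.2))
    (mem_extChartAt_target x₀)) (hfst.prodMk_space (hinv.clm_apply contMDiffAt_snd))
  refine h.congr_of_eventuallyEq ?_
  filter_upwards [continuousAt_fst.eventually (extChartAt_source_mem_nhds (I := 𝓘(ℂ, E)) x₀)]
    with y hy
  exact η.lift_eq_localVector hy y.2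

lemma induced_isInvertible (η : Coframe E M V) (u : TangentBundle 𝓘(ℂ, E) M) :
    (η.induced u).IsInvertible := by
  have hproj : MDifferentiableAt 𝓘(ℂ, E).tangent 𝓘(ℂ, E)
      (fun v : TangentBundle 𝓘(ℂ, E) M => v.1) u :=
    (Bundle.contMDiff_proj (n := 1) (TangentSpace 𝓘(ℂ, E))).mdifferentiable one_ne_zero u
  have hmu : MDifferentiableAt 𝓘(ℂ, E).tangent 𝓘(ℂ, V) η.mu u :=
    η.holomorphic.mdifferentiable (by simp) u
  have hΨ := mfderiv_prodMk hproj hmu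
  have hlift : MDifferentiableAt (𝓘(ℂ, E).prod 𝓘(ℂ, V)) 𝓘(ℂ, E).tangent η.lift (u.1, η.mu u) :=
    η.contMDiff_lift.mdifferentiable (by simp) _
  have hcomp := mfderiv_comp u hlift (hproj.prodMk hmu)
  have hid : η.lift ∘ (fun v : TangentBundle 𝓘(ℂ, E) M => (v.1, η.mu v)) = id :=
    funext η.lift_mu
  rw [hid, mfderiv_id, hΨ] at hcomp
  have hinj : Function.Injective (η.induced u) := by
    rw [injective_iff_map_eq_zero]
    intro ξ hξ
    have h1 : mfderiv 𝓘(ℂ, E).tangent 𝓘(ℂ, E)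
        (fun v : TangentBundle 𝓘(ℂ, E) M => v.1) u ξ = 0 :=
      (map_eq_zero_iff _ (η.toEquiv u.1).injective).1 (congrArg Prod.fst hξ)
    have h2 : mfderiv 𝓘(ℂ, E).tangent 𝓘(ℂ, V) η.mu u ξ = 0 := congrArg Prod.snd hξ
    have h3 := DFunLike.congr_fun hcomp ξ
    refine h3.trans ?_
    have h4 : ((mfderiv 𝓘(ℂ, E).tangent 𝓘(ℂ, E)
        (fun v : TangentBundle 𝓘(ℂ, E) M => v.1) u).prod
        (mfderiv 𝓘(ℂ, E).tangent 𝓘(ℂ, V) η.mu u)) ξ = 0 := Prod.ext h1 h2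
    exact (congrArg (mfderiv (𝓘(ℂ, E).prod 𝓘(ℂ, V)) 𝓘(ℂ, E).tangent η.lift (u.1, η.mu u)) h4).trans
      (map_zero _)
  have e : E ≃L[ℂ] V := η.toEquiv u.1
  have hV : FiniteDimensional ℂ V := e.toLinearEquiv.finiteDimensional
  have hfin : Module.finrank ℂ (E × E) = Module.finrank ℂ (V × V) := by
    simp [e.toLinearEquiv.finrank_eq]
  have hinj' : Function.Injective (show E × E →L[ℂ] V × V from η.induced u).toLinearMap := hinj
  exact ⟨(LinearEquiv.ofInjectiveOfFinrankEq _ hinj' hfin).toContinuousLinearEquiv,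
    ContinuousLinearMap.ext fun _ => rfl⟩

lemma mfderiv_proj_geodesicFlow (η : Coframe E M V) (u : TangentBundle 𝓘(ℂ, E) M) :
    mfderiv 𝓘(ℂ, E).tangent 𝓘(ℂ, E) (fun v : TangentBundle 𝓘(ℂ, E) M => v.1) u
      (η.geodesicFlow u) = u.2 := by
  have h := (η.induced_isInvertible u).self_apply_inverse (η.mu u, 0)
  exact (η.toEquiv u.1).injective (congrArg Prod.fst h)

lemma mfderiv_mu_geodesicFlow (η : Coframe E M V) (u : TangentBundle 𝓘(ℂ, E) M) :
    mfderiv 𝓘(ℂ, E).tangent 𝓘(ℂ, V) η.mu u (η.geodesicFlow u) = 0 := by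
  have h := (η.induced_isInvertible u).self_apply_inverse (η.mu u, 0)
  exact congrArg Prod.snd h

/-- The structure function in the preferred chart at the point. -/
lemma structureFunction_coord (η : Coframe E M V) (x : M) (X Y : E) :
    η.structureFunction x ![η.coord x (extChartAt 𝓘(ℂ, E) x x) X,
      η.coord x (extChartAt 𝓘(ℂ, E) x x) Y] =
      (1 / 2 : ℂ) • (fderiv ℂ (η.coord x) (extChartAt 𝓘(ℂ, E) x x) X Y -
        fderiv ℂ (η.coord x) (extChartAt 𝓘(ℂ, E) x x) Y X) := by
  set e := extChartAt 𝓘(ℂ, E) x x with he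
  have hinv := η.coord_isInvertible (mem_extChartAt_target (I := 𝓘(ℂ, E)) x)
  have hpull : ∀ X : E, mfderiv 𝓘(ℂ, E) 𝓘(ℂ, E) (extChartAt 𝓘(ℂ, E) x) x
      ((η.toEquiv x).symm (η.coord x e X)) = X := fun X =>
    (η.coord_inverse_apply (mem_extChartAt_source x) _).symm.trans (hinv.inverse_apply_self X)
  have hvec : ∀ i : Fin 2, mfderiv 𝓘(ℂ, E) 𝓘(ℂ, E) (extChartAt 𝓘(ℂ, E) x) x
      ((η.toEquiv x).symm (![η.coord x e X, η.coord x e Y] i)) = (![X, Y] : Fin 2 → E) i := by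
    intro i
    fin_cases i
    · exact hpull X
    · exact hpull Y
  have hd : DifferentiableAt ℂ (η.coord x) e :=
    (η.contDiffAt_coord (mem_extChartAt_target x)).differentiableAt (by simp)
  have hd' : DifferentiableAt ℂ (η.inChart x) e :=
    (ContinuousAlternatingMap.ofSubsingletonLIE (𝕜 := ℂ) (E := E) (F := V)
      (0 : Fin 1)).toContinuousLinearEquiv.differentiable.differentiableAt.comp e hd
  have hfd : ∀ X Y : E, fderiv ℂ (fun y => η.coord x y Y) e X = fderiv ℂ (η.coord x) e X Y := by
    intro X Y
    rw [fderiv_clm_apply hd (differentiableAt_const Y)]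
    simp
  have hext : extDeriv (η.inChart x) e ![X, Y] =
      fderiv ℂ (η.coord x) e X Y - fderiv ℂ (η.coord x) e Y X := by
    rw [extDeriv_apply hd', Fin.sum_univ_two, ← hfd, ← hfd, sub_eq_add_neg]
    simp
    rfl
  rw [← hext]
  change (1 / 2 : ℂ) • extDeriv (η.inChart x) e (fun i => mfderiv 𝓘(ℂ, E) 𝓘(ℂ, E)
    (extChartAt 𝓘(ℂ, E) x) x ((η.toEquiv x).symm (![η.coord x e X, η.coord x e Y] i))) = _
  congr 2
  exact funext hvec

end Coframe

/-! ### Immersions, submersions and the inverse function theorem -/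

section Calculus

variable {B N F G : Type*} [NormedAddCommGroup B] [NormedSpace ℂ B]
  [NormedAddCommGroup F] [NormedSpace ℂ F] [NormedAddCommGroup G] [NormedSpace ℂ G]
  [TopologicalSpace N] [ChartedSpace B N]

lemma mfderiv_bijective_of_mem_maximalAtlas {e : OpenPartialHomeomorph N B}
    (he : e ∈ IsManifold.maximalAtlas 𝓘(ℂ, B) ω N) {x : N} (hx : x ∈ e.source) :
    Function.Bijective (mfderiv 𝓘(ℂ, B) 𝓘(ℂ, B) e x) := by
  have h : e.MDifferentiable 𝓘(ℂ, B) 𝓘(ℂ, B) :=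
    ⟨(contMDiffOn_of_mem_maximalAtlas he).mdifferentiableOn (by simp),
      (contMDiffOn_symm_of_mem_maximalAtlas he).mdifferentiableOn (by simp)⟩
  exact h.mfderiv_bijective hx

variable {P : Type*} [TopologicalSpace P] [ChartedSpace F P]

lemma mfderiv_injective_of_isImmersionAt {f : N → P} {x : N}
    (hf : IsImmersionAt 𝓘(ℂ, B) 𝓘(ℂ, F) ω f x) :
    Function.Injective (mfderiv 𝓘(ℂ, B) 𝓘(ℂ, F) f x) := by
  have hdom := hf.domChart_mem_maximalAtlas
  have hcod := hf.codChart_mem_maximalAtlas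
  have hx := hf.mem_domChart_source
  have hfx := hf.mem_codChart_source
  have hev : hf.codChart ∘ f =ᶠ[𝓝 x] (fun z => hf.equiv (z, 0)) ∘ hf.domChart := by
    filter_upwards [hf.domChart.open_source.mem_nhds hx] with y hy
    have h := hf.writtenInCharts ((hf.domChart.extend 𝓘(ℂ, B)).map_source
      (by rwa [OpenPartialHomeomorph.extend_source]))
    simpa [hf.domChart.left_inv hy] using h
  have hd : MDifferentiableAt 𝓘(ℂ, B) 𝓘(ℂ, B) hf.domChart x :=
    (contMDiffAt_of_mem_maximalAtlas hdom hx).mdifferentiableAt (by simp)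
  have hc : MDifferentiableAt 𝓘(ℂ, F) 𝓘(ℂ, F) hf.codChart (f x) :=
    (contMDiffAt_of_mem_maximalAtlas hcod hfx).mdifferentiableAt (by simp)
  have hfd : MDifferentiableAt 𝓘(ℂ, B) 𝓘(ℂ, F) f x := hf.contMDiffAt.mdifferentiableAt (by simp)
  set j : B →L[ℂ] F := (hf.equiv : (B × hf.complement) →L[ℂ] F).comp
    (ContinuousLinearMap.inl ℂ B hf.complement) with hj
  have hjinj : Function.Injective j := fun a b hab =>
    congrArg Prod.fst (hf.equiv.injective hab : ((a, 0) : B × hf.complement) = (b, 0))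
  have h1 := mfderiv_comp x hc hfd
  have h2 : mfderiv 𝓘(ℂ, B) 𝓘(ℂ, F) (j ∘ hf.domChart) x = _ :=
    mfderiv_comp x (j.mdifferentiableAt (x := hf.domChart x)) hd
  have h3 : mfderiv 𝓘(ℂ, B) 𝓘(ℂ, F) (hf.codChart ∘ f) x =
      mfderiv 𝓘(ℂ, B) 𝓘(ℂ, F) (j ∘ hf.domChart) x := hev.mfderiv_eq
  rw [h1, h2, j.mfderiv_eq] at h3
  refine Function.Injective.of_comp (f := mfderiv 𝓘(ℂ, F) 𝓘(ℂ, F) hf.codChart (f x)) ?_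
  intro a b hab
  have h4 : j (mfderiv 𝓘(ℂ, B) 𝓘(ℂ, B) hf.domChart x a) =
      j (mfderiv 𝓘(ℂ, B) 𝓘(ℂ, B) hf.domChart x b) :=
    ((DFunLike.congr_fun h3 a).symm.trans hab).trans (DFunLike.congr_fun h3 b)
  exact (mfderiv_bijective_of_mem_maximalAtlas hdom hx).1 (hjinj h4)

lemma mfderiv_surjective_of_isSubmersionAt {f : N → P} {x : N}
    (hf : IsSubmersionAt 𝓘(ℂ, B) 𝓘(ℂ, F) ω f x) :
    Function.Surjective (mfderiv 𝓘(ℂ, B) 𝓘(ℂ, F) f x) := by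
  have hdom := hf.domChart_mem_maximalAtlas
  have hcod := hf.codChart_mem_maximalAtlas
  have hx := hf.mem_domChart_source
  have hfx := hf.mem_codChart_source
  set j : B →L[ℂ] F := (ContinuousLinearMap.fst ℂ F hf.complement).comp
    (hf.equiv : B →L[ℂ] (F × hf.complement)) with hj
  have hev : hf.codChart ∘ f =ᶠ[𝓝 x] j ∘ hf.domChart := by
    filter_upwards [hf.domChart.open_source.mem_nhds hx] with y hy
    have h := hf.writtenInCharts ((hf.domChart.extend 𝓘(ℂ, B)).map_source
      (by rwa [OpenPartialHomeomorph.extend_source]))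
    have h' : hf.codChart (f y) = (hf.equiv (hf.domChart y)).1 := by
      simpa [hf.domChart.left_inv hy] using h
    exact h'
  have hd : MDifferentiableAt 𝓘(ℂ, B) 𝓘(ℂ, B) hf.domChart x :=
    (contMDiffAt_of_mem_maximalAtlas hdom hx).mdifferentiableAt (by simp)
  have hc : MDifferentiableAt 𝓘(ℂ, F) 𝓘(ℂ, F) hf.codChart (f x) :=
    (contMDiffAt_of_mem_maximalAtlas hcod hfx).mdifferentiableAt (by simp)
  have hfd : MDifferentiableAt 𝓘(ℂ, B) 𝓘(ℂ, F) f x := hf.contMDiffAt.mdifferentiableAt (by simp)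
  have hjsurj : Function.Surjective j := fun a =>
    ⟨hf.equiv.symm (a, 0), congrArg Prod.fst (hf.equiv.apply_symm_apply (a, 0))⟩
  have h1 := mfderiv_comp x hc hfd
  have h2 : mfderiv 𝓘(ℂ, B) 𝓘(ℂ, F) (j ∘ hf.domChart) x = _ :=
    mfderiv_comp x (j.mdifferentiableAt (x := hf.domChart x)) hd
  have h3 : mfderiv 𝓘(ℂ, B) 𝓘(ℂ, F) (hf.codChart ∘ f) x =
      mfderiv 𝓘(ℂ, B) 𝓘(ℂ, F) (j ∘ hf.domChart) x := hev.mfderiv_eq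
  rw [h1, h2, j.mfderiv_eq] at h3
  intro a
  obtain ⟨b, hb⟩ := hjsurj (mfderiv 𝓘(ℂ, F) 𝓘(ℂ, F) hf.codChart (f x) a)
  obtain ⟨c, hc'⟩ := (mfderiv_bijective_of_mem_maximalAtlas hdom hx).2 b
  refine ⟨c, (mfderiv_bijective_of_mem_maximalAtlas hcod hfx).1 ?_⟩
  exact (DFunLike.congr_fun h3 c).trans ((congrArg j hc').trans hb)

lemma isInvertible_of_injective [FiniteDimensional ℂ B] [FiniteDimensional ℂ F]
    (h : Module.finrank ℂ B = Module.finrank ℂ F) (L : B →L[ℂ] F) (hL : Function.Injective L) :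
    L.IsInvertible :=
  ⟨(LinearEquiv.ofInjectiveOfFinrankEq L.toLinearMap hL h).toContinuousLinearEquiv,
    ContinuousLinearMap.ext fun _ => rfl⟩

variable [IsManifold 𝓘(ℂ, B) ω N]

/-- The inverse function theorem for a holomorphic map from a manifold to a vector space. The
differential stays invertible nearby because the local inverse `R` is also a left inverse there. -/
theorem exists_local_inverse [FiniteDimensional ℂ B] [FiniteDimensional ℂ F]
    {κ : N → F} {c : N}
    (hκ : ContMDiffAt 𝓘(ℂ, B) 𝓘(ℂ, F) ω κ c)
    (h : (mfderiv 𝓘(ℂ, B) 𝓘(ℂ, F) κ c).IsInvertible) :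
    ∃ R : F → N, ContMDiffAt 𝓘(ℂ, F) 𝓘(ℂ, B) ω R (κ c) ∧ R (κ c) = c ∧
      (∀ᶠ c' in 𝓝 c, R (κ c') = c') ∧
      ∀ᶠ c' in 𝓝 c, (mfderiv 𝓘(ℂ, B) 𝓘(ℂ, F) κ c').IsInvertible := by
  have : CompleteSpace B := FiniteDimensional.complete ℂ B
  set φ := extChartAt 𝓘(ℂ, B) c with hφ
  have hc : φ.symm (φ c) = c := extChartAt_to_inv c
  have hsymm : ContMDiffAt 𝓘(ℂ, B) 𝓘(ℂ, B) ω φ.symm (φ c) :=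
    contMDiffAt_extChartAt_symm (mem_extChartAt_target c)
  have hκ' : ContMDiffAt 𝓘(ℂ, B) 𝓘(ℂ, F) ω κ (φ.symm (φ c)) := by rwa [hc]
  have hinv' : (mfderiv 𝓘(ℂ, B) 𝓘(ℂ, F) κ (φ.symm (φ c))).IsInvertible := by rwa [hc]
  have hK : ContDiffAt ℂ ω (κ ∘ φ.symm) (φ c) := by
    rw [← contMDiffAt_iff_contDiffAt]
    exact ContMDiffAt.comp (φ c) hκ' hsymm
  have hsinv := isInvertible_mfderivWithin_extChartAt_symm (I := 𝓘(ℂ, B))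
    (mem_extChartAt_target (I := 𝓘(ℂ, B)) c)
  simp only [modelWithCornersSelf_coe, Set.range_id, mfderivWithin_univ] at hsinv
  have hcomp := mfderiv_comp (φ c) (hκ'.mdifferentiableAt (by simp))
    (hsymm.mdifferentiableAt (by simp))
  have hKinv : (fderiv ℂ (κ ∘ φ.symm) (φ c)).IsInvertible := by
    rw [← mfderiv_eq_fderiv, hcomp]
    exact hinv'.comp hsinv
  obtain ⟨K', hK'⟩ := hKinv
  have hder : HasFDerivAt (κ ∘ φ.symm) (K' : B →L[ℂ] F) (φ c) := by
    rw [hK']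
    exact (hK.differentiableAt (by simp)).hasFDerivAt
  have hfin : Module.finrank ℂ B = Module.finrank ℂ F := K'.toLinearEquiv.finrank_eq
  have hω : (ω : WithTop ℕ∞) ≠ 0 := by simp
  set Q := hK.toOpenPartialHomeomorph _ hder hω with hQ
  have hQs : φ c ∈ Q.source := hK.mem_toOpenPartialHomeomorph_source hder hω
  have hQsymm : ContDiffAt ℂ ω Q.symm (κ c) := by
    have := hK.to_localInverse hder hω
    rwa [Function.comp_apply, hc] at this
  have hQc : Q.symm (κ c) = φ c := by
    have := Q.left_inv hQs
    rwa [hQ, hK.toOpenPartialHomeomorph_coe hder hω, Function.comp_apply, hc] at this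
  have hR : ContMDiffAt 𝓘(ℂ, F) 𝓘(ℂ, B) ω (φ.symm ∘ Q.symm) (κ c) :=
    ContMDiffAt.comp (κ c) (hQc.symm ▸ hsymm) hQsymm.contMDiffAt
  have hRκ : ∀ᶠ c' in 𝓝 c, φ.symm (Q.symm (κ c')) = c' := by
    filter_upwards [extChartAt_source_mem_nhds (I := 𝓘(ℂ, B)) c,
      (continuousAt_extChartAt (I := 𝓘(ℂ, B)) c) (Q.open_source.mem_nhds hQs)] with c' hc' hc''
    have h1 := Q.left_inv hc''
    rw [hQ, hK.toOpenPartialHomeomorph_coe hder hω, Function.comp_apply, φ.left_inv hc'] at h1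
    rw [h1, φ.left_inv hc']
  have hRc : φ.symm (Q.symm (κ c)) = c := by rw [hQc, hc]
  refine ⟨φ.symm ∘ Q.symm, hR, hRc, hRκ, ?_⟩
  have h1 := (contMDiffAt_iff_contMDiffAt_nhds (by simp)).1 hκ
  have h2 := hκ.continuousAt.eventually ((contMDiffAt_iff_contMDiffAt_nhds (by simp)).1 hR)
  filter_upwards [h1, h2, hRκ.eventually_nhds] with c' h1 h2 h3
  refine isInvertible_of_injective hfin (mfderiv 𝓘(ℂ, B) 𝓘(ℂ, F) κ c') ?_
  have h4 := mfderiv_comp c' (h2.mdifferentiableAt (by simp)) (h1.mdifferentiableAt (by simp))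
  have h5 : (φ.symm ∘ Q.symm) ∘ κ =ᶠ[𝓝 c'] id := h3
  have h6 := h4.symm.trans (h5.mfderiv_eq.trans mfderiv_id)
  intro a b hab
  exact ((DFunLike.congr_fun h6 a).symm.trans (congrArg
    (mfderiv 𝓘(ℂ, F) 𝓘(ℂ, B) (φ.symm ∘ Q.symm) (κ c')) hab)).trans (DFunLike.congr_fun h6 b)

/-- If `a` is surjective and `(a, b)` is injective, then projecting the target of `b` linearly
makes `(a, b)` an isomorphism. -/
lemma exists_complementary_projection [FiniteDimensional ℂ B] [FiniteDimensional ℂ G]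
    (a : B →L[ℂ] F) (b : B →L[ℂ] G) (ha : Function.Surjective a)
    (hab : ∀ h, a h = 0 → b h = 0 → h = 0) :
    ∃ L : G →L[ℂ] a.ker, Function.Bijective fun h => (a h, L (b h)) := by
  have hinj : Function.Injective (b.toLinearMap.comp a.ker.subtype) := by
    rw [injective_iff_map_eq_zero]
    intro h hh
    exact Subtype.ext (hab h h.2 hh)
  obtain ⟨L, hL⟩ := (b.toLinearMap.comp a.ker.subtype).exists_leftInverse_of_injective
    (LinearMap.ker_eq_bot.2 hinj)
  have hL' : ∀ f : a.ker, L (b f) = f := fun f => DFunLike.congr_fun hL f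
  refine ⟨L.toContinuousLinearMap, fun h h' hh => ?_, fun z => ?_⟩
  · have h1 : a (h - h') = 0 := by rw [map_sub, sub_eq_zero]; exact congrArg Prod.fst hh
    have h2 : L (b (h - h')) = 0 := by
      rw [map_sub, map_sub, sub_eq_zero]; exact congrArg Prod.snd hh
    have h3 := hL' ⟨h - h', h1⟩
    rw [h2] at h3
    exact sub_eq_zero.1 (congrArg Subtype.val h3).symm
  · obtain ⟨h, hh⟩ := ha z.1
    set f : a.ker := z.2 - L (b h) with hf
    have hf0 : a f = 0 := f.2
    refine ⟨h + f, Prod.ext ?_ ?_⟩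
    · simp [hh, hf0]
    · change L (b (h + f)) = z.2
      rw [map_add, map_add, hL', hf]
      abel

end Calculus

section Cones

variable {W W' : Type*} [AddCommGroup W] [Module ℂ W] [AddCommGroup W'] [Module ℂ W']

lemma smul_mem_affineCone {S : Set (ℙ ℂ W)} {w : W} (hw : w ∈ affineCone S) (a : ℂ) :
    a • w ∈ affineCone S := by
  intro h
  have ha : a ≠ 0 := left_ne_zero_of_smul h
  have hw0 : w ≠ 0 := right_ne_zero_of_smul h
  have : Projectivization.mk ℂ (a • w) h = Projectivization.mk ℂ w hw0 :=
    (Projectivization.mk_eq_mk_iff' ℂ _ _ _ _).2 ⟨a, rfl⟩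
  rw [this]
  exact hw hw0

end Cones

section Velocities

variable {W W' : Type*} [NormedAddCommGroup W] [NormedSpace ℂ W]
  [NormedAddCommGroup W'] [NormedSpace ℂ W']

/-- Linear isomorphisms map affine tangent spaces to affine tangent spaces, as they map curves on
the cone to curves on the cone. -/
lemma mem_affineTangentSpace_of_map (A : W ≃L[ℂ] W') {S : Set (ℙ ℂ W)} {α : ℙ ℂ W}
    {w : W} (hw : w ∈ affineTangentSpace S α) :
    A w ∈ affineTangentSpace (Projectivization.map A.toLinearEquiv.toLinearMap A.injective '' S)
      (Projectivization.map A.toLinearEquiv.toLinearMap A.injective α) := by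
  have hle : affineTangentSpace S α ≤ (affineTangentSpace
      (Projectivization.map A.toLinearEquiv.toLinearMap A.injective '' S)
      (Projectivization.map A.toLinearEquiv.toLinearMap A.injective α)).comap
        A.toLinearEquiv.toLinearMap := by
    refine Submodule.span_le.2 ?_
    rintro w ⟨c, hc0, hcα, hc, hw⟩
    refine Submodule.subset_span ⟨fun t => A (c t), ?_, ?_, ?_, ?_⟩
    · exact fun h => hc0 ((map_eq_zero_iff A A.injective).1 h)
    · induction α using Projectivization.ind with
      | h v hv =>
        rw [Projectivization.submodule_mk, Submodule.mem_span_singleton] at hcα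
        obtain ⟨a, ha⟩ := hcα
        rw [Projectivization.map_mk, Projectivization.submodule_mk, Submodule.mem_span_singleton]
        exact ⟨a, (map_smul A a v).symm.trans (congrArg A ha)⟩
    · filter_upwards [hc] with t ht
      refine ⟨A.differentiableAt.comp t ht.1, fun h => ?_⟩
      have h0 : c t ≠ 0 := fun h0 => h (by rw [h0, map_zero])
      exact ⟨_, ht.2 h0, rfl⟩
    · exact (A : W →L[ℂ] W').hasFDerivAt.comp_hasDerivAt 0 hw
  exact hle hw

end Velocities

/-! ### Normalized vectors of the cone -/

namespace Coframe

section

variable {E M V : Type*} [NormedAddCommGroup E] [NormedSpace ℂ E]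
  [TopologicalSpace M] [ChartedSpace E M] [IsManifold 𝓘(ℂ, E) ω M]
  [NormedAddCommGroup V] [NormedSpace ℂ V]

/-- The vector of `V` on the line `η_x(α)`, `α` a line in `T_x(M)`, normalized by `ℓ = 1`. It is
`0` if `ℓ` vanishes on that line. -/
noncomputable def coneVec (η : Coframe E M V) (ℓ : V →L[ℂ] ℂ) (p : ProjTangentBundle E M) : V :=
  (ℓ (η.toEquiv p.base p.line.rep))⁻¹ • η.toEquiv p.base p.line.rep

variable (η : Coframe E M V) (ℓ : V →L[ℂ] ℂ)

lemma apply_coneVec {p : ProjTangentBundle E M} (hp : η.coneVec ℓ p ≠ 0) :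
    ℓ (η.coneVec ℓ p) = 1 := by
  have h := left_ne_zero_of_smul hp
  exact (map_smul ℓ _ _).trans (inv_mul_cancel₀ (inv_eq_zero.not.1 h))

/-- `coneVec` does not depend on the representative of the line. -/
lemma coneVec_mk {x : M} {w : TangentSpace 𝓘(ℂ, E) x} (hw : w ≠ 0) :
    η.coneVec ℓ ⟨x, Projectivization.mk ℂ w hw⟩ = (ℓ (η.toEquiv x w))⁻¹ • η.toEquiv x w := by
  obtain ⟨a, ha⟩ := Projectivization.exists_smul_eq_mk_rep ℂ w hw
  have ha0 : (a : ℂ) ≠ 0 := a.ne_zero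
  simp only [coneVec, ← ha, Units.smul_def, map_smul, smul_eq_mul, mul_inv, smul_smul]
  congr 1
  field_simp

lemma coneVec_ofVector (p : ProjTangentBundle E M) {v : TangentBundle 𝓘(ℂ, E) M} (hv : v.2 ≠ 0) :
    η.coneVec ℓ (ofVector p v) = (ℓ (η.mu v))⁻¹ • η.mu v := by
  rw [ofVector, dif_pos hv]
  exact η.coneVec_mk ℓ hv

lemma lift_snd_ne_zero {z : M × V} (hz : z.2 ≠ 0) : (η.lift z).2 ≠ 0 := fun h =>
  hz ((map_eq_zero_iff (η.toEquiv z.1).symm (η.toEquiv z.1).symm.injective).1 h)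

lemma coneVec_ofVector_lift (p : ProjTangentBundle E M) {z : M × V} (hz : ℓ z.2 = 1) :
    η.coneVec ℓ (ofVector p (η.lift z)) = z.2 := by
  have h0 : z.2 ≠ 0 := fun h => by simp [h] at hz
  rw [η.coneVec_ofVector ℓ p (η.lift_snd_ne_zero h0), mu_lift, hz, inv_one, one_smul]

/-- A line in `T_x(M)` is recovered from `x` and its normalized vector in `V`. -/
lemma ofVector_lift_coneVec (p : ProjTangentBundle E M) {q : ProjTangentBundle E M}
    (hq : η.coneVec ℓ q ≠ 0) : ofVector p (η.lift (q.base, η.coneVec ℓ q)) = q := by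
  have h0 := η.lift_snd_ne_zero (z := (q.base, η.coneVec ℓ q)) hq
  rw [ofVector, dif_pos h0]
  rcases q with ⟨x, l⟩
  congr 1
  refine Eq.trans ?_ l.mk_rep
  refine (Projectivization.mk_eq_mk_iff' ℂ _ _ _ _).2 ⟨(ℓ (η.toEquiv x l.rep))⁻¹, ?_⟩
  change _ = (η.toEquiv x).symm ((ℓ (η.toEquiv x l.rep))⁻¹ • η.toEquiv x l.rep)
  rw [map_smul, ContinuousLinearEquiv.symm_apply_apply]
  rfl

variable [FiniteDimensional ℂ E]

lemma contMDiffAt_normalize {v : V} (hv : ℓ v ≠ 0) :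
    ContMDiffAt 𝓘(ℂ, V) 𝓘(ℂ, V) ω (fun v => (ℓ v)⁻¹ • v) v :=
  ((ℓ.contDiff.contDiffAt.inv hv).smul contDiffAt_id).contMDiffAt

lemma contMDiffAt_coneVec {p : ProjTangentBundle E M} (hp : η.coneVec ℓ p ≠ 0) :
    ContMDiffAt 𝓘(ℂ, E × AffineModel E) 𝓘(ℂ, V) ω (η.coneVec ℓ) p := by
  obtain ⟨T, hT, hTp⟩ := exists_local_lift p
  have h0 : ℓ (η.mu (T p)) ≠ 0 := by
    have h := η.coneVec_ofVector ℓ p hTp.self_of_nhds.1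
    rw [hTp.self_of_nhds.2] at h
    rw [h] at hp
    exact inv_eq_zero.not.1 (left_ne_zero_of_smul hp)
  have hmu : ContMDiffAt 𝓘(ℂ, E × AffineModel E) 𝓘(ℂ, V) ω (fun q => η.mu (T q)) p :=
    ContMDiffAt.comp p (g := η.mu) η.holomorphic.contMDiffAt hT
  refine (ContMDiffAt.comp p (contMDiffAt_normalize ℓ h0) hmu).congr_of_eventuallyEq ?_
  filter_upwards [hTp] with q hq
  have h := η.coneVec_ofVector ℓ p hq.1
  rwa [hq.2] at h

lemma eventually_coneVec_ne_zero {p : ProjTangentBundle E M} (hp : η.coneVec ℓ p ≠ 0) :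
    ∀ᶠ q in 𝓝 p, η.coneVec ℓ q ≠ 0 :=
  (η.contMDiffAt_coneVec ℓ hp).continuousAt.eventually_ne hp

lemma contMDiffAt_ofVector_lift (p : ProjTangentBundle E M) {z : M × V} (hz : z.2 ≠ 0) :
    ContMDiffAt (𝓘(ℂ, E).prod 𝓘(ℂ, V)) 𝓘(ℂ, E × AffineModel E) ω
      (fun z => ofVector p (η.lift z)) z :=
  ContMDiffAt.comp z (contMDiffAt_ofVector p _ (η.lift_snd_ne_zero hz)) η.contMDiff_lift.contMDiffAt

/-- A tangent vector of `ℙ T(M)` is determined by the velocities of the base point and of the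
normalized vector of the cone. -/
lemma projTangent_tangent_ext {p : ProjTangentBundle E M} (hp : η.coneVec ℓ p ≠ 0)
    {ξ ζ : TangentSpace 𝓘(ℂ, E × AffineModel E) p}
    (hbase : mfderiv 𝓘(ℂ, E × AffineModel E) 𝓘(ℂ, E)
        (ProjTangentBundle.base : ProjTangentBundle E M → M) p ξ =
      mfderiv 𝓘(ℂ, E × AffineModel E) 𝓘(ℂ, E)
        (ProjTangentBundle.base : ProjTangentBundle E M → M) p ζ)
    (hcone : mfderiv 𝓘(ℂ, E × AffineModel E) 𝓘(ℂ, V) (η.coneVec ℓ) p ξ =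
      mfderiv 𝓘(ℂ, E × AffineModel E) 𝓘(ℂ, V) (η.coneVec ℓ) p ζ) : ξ = ζ := by
  have h1 : MDifferentiableAt 𝓘(ℂ, E × AffineModel E) 𝓘(ℂ, E)
      (ProjTangentBundle.base : ProjTangentBundle E M → M) p :=
    (contMDiffAt_base p).mdifferentiableAt (by simp)
  have h2 : MDifferentiableAt 𝓘(ℂ, E × AffineModel E) 𝓘(ℂ, V) (η.coneVec ℓ) p :=
    (η.contMDiffAt_coneVec ℓ hp).mdifferentiableAt (by simp)
  have h3 : MDifferentiableAt (𝓘(ℂ, E).prod 𝓘(ℂ, V)) 𝓘(ℂ, E × AffineModel E)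
      (fun z => ofVector p (η.lift z)) (p.base, η.coneVec ℓ p) :=
    (η.contMDiffAt_ofVector_lift p hp).mdifferentiableAt (by simp)
  have hcomp := mfderiv_comp p h3 (h1.prodMk h2)
  have hid : (fun z => ofVector p (η.lift z)) ∘ (fun q => (q.base, η.coneVec ℓ q)) =ᶠ[𝓝 p] id := by
    filter_upwards [η.eventually_coneVec_ne_zero ℓ hp] with q hq
    exact η.ofVector_lift_coneVec ℓ p hq
  have h4 := hcomp.symm.trans (hid.mfderiv_eq.trans mfderiv_id)
  rw [mfderiv_prodMk h1 h2] at h4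
  have h5 : ((mfderiv 𝓘(ℂ, E × AffineModel E) 𝓘(ℂ, E)
      (ProjTangentBundle.base : ProjTangentBundle E M → M) p).prod
      (mfderiv 𝓘(ℂ, E × AffineModel E) 𝓘(ℂ, V) (η.coneVec ℓ) p)) ξ =
      ((mfderiv 𝓘(ℂ, E × AffineModel E) 𝓘(ℂ, E)
      (ProjTangentBundle.base : ProjTangentBundle E M → M) p).prod
      (mfderiv 𝓘(ℂ, E × AffineModel E) 𝓘(ℂ, V) (η.coneVec ℓ) p)) ζ := Prod.ext hbase hcone
  exact ((DFunLike.congr_fun h4 ξ).symm.trans (congrArg (mfderiv (𝓘(ℂ, E).prod 𝓘(ℂ, V))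
    𝓘(ℂ, E × AffineModel E) (fun z => ofVector p (η.lift z)) (p.base, η.coneVec ℓ p))
    h5)).trans (DFunLike.congr_fun h4 ζ)

end

end Coframe

lemma projectivization_map_symm_map {W W' : Type*} [AddCommGroup W] [Module ℂ W] [AddCommGroup W']
    [Module ℂ W'] (A : W ≃ₗ[ℂ] W') (l : ℙ ℂ W) :
    Projectivization.map A.symm.toLinearMap A.symm.injective
      (Projectivization.map A.toLinearMap A.injective l) = l := by
  induction l using Projectivization.ind with
  | h v hv =>
    rw [Projectivization.map_mk, Projectivization.map_mk]
    congr 1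
    exact A.symm_apply_apply v

section Adapted

variable {E M V : Type*} [NormedAddCommGroup E] [NormedSpace ℂ E]
  [TopologicalSpace M] [ChartedSpace E M] [IsManifold 𝓘(ℂ, E) ω M]
  [NormedAddCommGroup V] [NormedSpace ℂ V]
  {Z : Set (ℙ ℂ V)} {C : Set (ProjTangentBundle E M)} {η : Coframe E M V}

lemma IsAdapted.coneVec_mem (hη : IsAdapted Z C η) (ℓ : V →L[ℂ] ℂ) {p : ProjTangentBundle E M}
    (hp : p ∈ C) : η.coneVec ℓ p ∈ affineCone Z := by
  refine smul_mem_affineCone (fun h => ?_) _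
  rw [← hη p.base]
  refine ⟨p.line, hp, ?_⟩
  conv_lhs => rw [← p.line.mk_rep]
  rfl

lemma IsAdapted.ofVector_lift_mem (hη : IsAdapted Z C η) (p : ProjTangentBundle E M) {z : M × V}
    (hz : z.2 ∈ affineCone Z) (hz0 : z.2 ≠ 0) : ofVector p (η.lift z) ∈ C := by
  have h0 := η.lift_snd_ne_zero hz0
  have h := hz hz0
  rw [← hη z.1] at h
  obtain ⟨l, hl, hlz⟩ := h
  rw [ofVector, dif_pos h0]
  have : l = Projectivization.mk ℂ (η.lift z).2 h0 := by
    refine Projectivization.map_injective _ (η.toEquiv z.1).injective (hlz.trans ?_)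
    refine (Projectivization.mk_eq_mk_iff' ℂ _ _ _ _).2 ⟨1, ?_⟩
    exact (one_smul ℂ _).trans ((η.toEquiv z.1).apply_symm_apply z.2)
  rw [← this]
  exact hl

/-- An adapted coframe matches the affine tangent spaces of `C_x` with those of `Z`. -/
lemma IsAdapted.mem_affineTangentSpace_iff (hη : IsAdapted Z C η) (x : M)
    (l : ℙ ℂ (TangentSpace 𝓘(ℂ, E) x)) (w : TangentSpace 𝓘(ℂ, E) x) :
    w ∈ affineTangentSpace (fiber C x) l ↔ η.toEquiv x w ∈ affineTangentSpace Z
      (Projectivization.map (η.toEquiv x).toLinearEquiv.toLinearMap (η.toEquiv x).injective l) := by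
  constructor
  · intro h
    rw [← hη x]
    exact mem_affineTangentSpace_of_map (W := E) (η.toEquiv x) h
  · intro h
    have h1 := mem_affineTangentSpace_of_map (W' := E) (η.toEquiv x).symm h
    have key : ∀ (S : Set (ℙ ℂ (TangentSpace 𝓘(ℂ, E) x))) l' w', S = fiber C x → l' = l → w' = w →
        w' ∈ affineTangentSpace S l' → w ∈ affineTangentSpace (fiber C x) l := by
      rintro _ _ _ rfl rfl rfl h
      exact h
    have hsymm := projectivization_map_symm_map (η.toEquiv x).toLinearEquiv
    rw [← hη x, ← Set.image_comp] at h1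
    have himage : (Projectivization.map (η.toEquiv x).symm.toLinearEquiv.toLinearMap
        (η.toEquiv x).symm.injective ∘ Projectivization.map (η.toEquiv x).toLinearEquiv.toLinearMap
          (η.toEquiv x).injective) '' fiber C x = fiber C x :=
      (congrArg (· '' fiber C x) (funext hsymm)).trans (Set.image_id _)
    exact key _ _ _ himage (hsymm l) ((η.toEquiv x).symm_apply_apply w) h1

end Adapted

/-! ### Coordinates of a cone structure adapted to a coframe -/

section ProductDerivative

variable {B N F G : Type*} [NormedAddCommGroup B] [NormedSpace ℂ B]
  [NormedAddCommGroup F] [NormedSpace ℂ F] [NormedAddCommGroup G] [NormedSpace ℂ G]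
  [TopologicalSpace N] [ChartedSpace B N] {κ : N → F × G} {c : N}

lemma mfderiv_fst_apply (hκ : MDifferentiableAt 𝓘(ℂ, B) 𝓘(ℂ, F × G) κ c)
    (h : TangentSpace 𝓘(ℂ, B) c) :
    mfderiv 𝓘(ℂ, B) 𝓘(ℂ, F) (fun c => (κ c).1) c h =
      Prod.fst (α := F) (β := G) (mfderiv 𝓘(ℂ, B) 𝓘(ℂ, F × G) κ c h) := by
  have h1 : mfderiv 𝓘(ℂ, B) 𝓘(ℂ, F) (ContinuousLinearMap.fst ℂ F G ∘ κ) c = _ :=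
    mfderiv_comp c ((ContinuousLinearMap.fst ℂ F G).mdifferentiableAt (x := κ c)) hκ
  rw [ContinuousLinearMap.mfderiv_eq] at h1
  exact DFunLike.congr_fun h1 h

lemma mfderiv_snd_apply (hκ : MDifferentiableAt 𝓘(ℂ, B) 𝓘(ℂ, F × G) κ c)
    (h : TangentSpace 𝓘(ℂ, B) c) :
    mfderiv 𝓘(ℂ, B) 𝓘(ℂ, G) (fun c => (κ c).2) c h =
      Prod.snd (α := F) (β := G) (mfderiv 𝓘(ℂ, B) 𝓘(ℂ, F × G) κ c h) := by
  have h1 : mfderiv 𝓘(ℂ, B) 𝓘(ℂ, G) (ContinuousLinearMap.snd ℂ F G ∘ κ) c = _ :=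
    mfderiv_comp c ((ContinuousLinearMap.snd ℂ F G).mdifferentiableAt (x := κ c)) hκ
  rw [ContinuousLinearMap.mfderiv_eq] at h1
  exact DFunLike.congr_fun h1 h

end ProductDerivative

section LocalStructure

variable {E M V B : Type*} [NormedAddCommGroup E] [NormedSpace ℂ E] [FiniteDimensional ℂ E]
  [TopologicalSpace M] [ChartedSpace E M] [IsManifold 𝓘(ℂ, E) ω M]
  [NormedAddCommGroup V] [NormedSpace ℂ V]
  [NormedAddCommGroup B] [NormedSpace ℂ B]
  {C : Set (ProjTangentBundle E M)} [ChartedSpace B C] [IsManifold 𝓘(ℂ, B) ω C]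

lemma IsConeStructure.contMDiff_val (hC : IsConeStructure (B := B) C) :
    ContMDiff 𝓘(ℂ, B) 𝓘(ℂ, E × AffineModel E) ω (Subtype.val : C → ProjTangentBundle E M) :=
  hC.submanifold.contMDiff

lemma IsConeStructure.contMDiff_proj (hC : IsConeStructure (B := B) C) :
    ContMDiff 𝓘(ℂ, B) 𝓘(ℂ, E) ω (proj C) :=
  hC.submersion.contMDiff

lemma IsConeStructure.mfderiv_val_injective (hC : IsConeStructure (B := B) C) (c : C) :
    Function.Injective (mfderiv 𝓘(ℂ, B) 𝓘(ℂ, E × AffineModel E)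
      (Subtype.val : C → ProjTangentBundle E M) c) :=
  mfderiv_injective_of_isImmersionAt (hC.submanifold.isImmersion.isImmersionAt c)

lemma IsConeStructure.mfderiv_proj_surjective (hC : IsConeStructure (B := B) C) (c : C) :
    Function.Surjective (mfderiv 𝓘(ℂ, B) 𝓘(ℂ, E) (proj C) c) :=
  mfderiv_surjective_of_isSubmersionAt (hC.submersion.isSubmersionAt c)

lemma IsConeStructure.mfderiv_base_val (hC : IsConeStructure (B := B) C) (c : C)
    (h : TangentSpace 𝓘(ℂ, B) c) :
    mfderiv 𝓘(ℂ, E × AffineModel E) 𝓘(ℂ, E)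
      (ProjTangentBundle.base : ProjTangentBundle E M → M) c.1
      (mfderiv 𝓘(ℂ, B) 𝓘(ℂ, E × AffineModel E) (Subtype.val : C → ProjTangentBundle E M) c h) =
      mfderiv 𝓘(ℂ, B) 𝓘(ℂ, E) (proj C) c h :=
  (DFunLike.congr_fun (mfderiv_comp c ((contMDiffAt_base c.1).mdifferentiableAt (by simp))
    (hC.contMDiff_val.mdifferentiable (by simp) c)) h).symm

variable {Z : Set (ℙ ℂ V)} (η : Coframe E M V) (ℓ : V →L[ℂ] ℂ)

lemma IsConeStructure.contMDiffAt_coneVec (hC : IsConeStructure (B := B) C) {c : C}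
    (hc : η.coneVec ℓ c.1 ≠ 0) :
    ContMDiffAt 𝓘(ℂ, B) 𝓘(ℂ, V) ω (fun c : C => η.coneVec ℓ c.1) c :=
  ContMDiffAt.comp c (η.contMDiffAt_coneVec ℓ hc) hC.contMDiff_val.contMDiffAt

lemma IsConeStructure.mfderiv_coneVec_val (hC : IsConeStructure (B := B) C) {c : C}
    (hc : η.coneVec ℓ c.1 ≠ 0) (h : TangentSpace 𝓘(ℂ, B) c) :
    mfderiv 𝓘(ℂ, E × AffineModel E) 𝓘(ℂ, V) (η.coneVec ℓ) c.1
      (mfderiv 𝓘(ℂ, B) 𝓘(ℂ, E × AffineModel E) (Subtype.val : C → ProjTangentBundle E M) c h) =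
      mfderiv 𝓘(ℂ, B) 𝓘(ℂ, V) (fun c : C => η.coneVec ℓ c.1) c h :=
  (DFunLike.congr_fun (mfderiv_comp c ((η.contMDiffAt_coneVec ℓ hc).mdifferentiableAt (by simp))
    (hC.contMDiff_val.mdifferentiable (by simp) c)) h).symm

/-- The coordinates on `C` near `c₀` given by the base point, read in the preferred chart at `x₀`,
and by the image under `L` of the normalized vector of the cone over `Z`. -/
noncomputable def coneCoord {F : Type*} [NormedAddCommGroup F] [NormedSpace ℂ F] (L : V →L[ℂ] F)
    (x₀ : M) (c : C) : E × F :=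
  (extChartAt 𝓘(ℂ, E) x₀ (proj C c), L (η.coneVec ℓ c.1))

/-- An adapted coframe trivializes the cone structure: near each of its points, `C` has coordinates
consisting of coordinates of `M` and of coordinates of `Z`. Here `g` parametrizes the slice `ℓ = 1`
of the cone over `Z`, with inverse `L`. The last condition says that no point of that slice near the
given one is missed: it holds because the coframe at the single point `proj C c₀` already matches
the fibre of `C` with `Z`. -/
theorem exists_adapted_coordinates [FiniteDimensional ℂ B] [FiniteDimensional ℂ V]
    (hC : IsConeStructure (B := B) C) (hη : IsAdapted Z C η) {c₀ : C}
    (hc₀ : η.coneVec ℓ c₀.1 ≠ 0) :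
    ∃ (F : Submodule ℂ B) (L : V →L[ℂ] F) (g : F → V),
      ContMDiffAt 𝓘(ℂ, B) 𝓘(ℂ, E × F) ω (coneCoord (C := C) η ℓ L (proj C c₀)) c₀ ∧
      (∀ᶠ c in 𝓝 c₀, (mfderiv 𝓘(ℂ, B) 𝓘(ℂ, E × F)
        (coneCoord (C := C) η ℓ L (proj C c₀)) c).IsInvertible) ∧
      ContDiffAt ℂ ω g (L (η.coneVec ℓ c₀.1)) ∧
      (∀ y, g y ∈ affineCone Z) ∧
      (∀ᶠ c : C in 𝓝 c₀, g (L (η.coneVec ℓ c.1)) = η.coneVec ℓ c.1) ∧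
      ∀ᶠ z in 𝓝 (η.coneVec ℓ c₀.1), z ∈ affineCone Z → ℓ z = 1 → g (L z) = z := by
  set x₀ := proj C c₀ with hx₀
  set φ := extChartAt 𝓘(ℂ, E) x₀ with hφ
  set G : C → V := fun c => η.coneVec ℓ c.1 with hG
  have hGc : ContMDiffAt 𝓘(ℂ, B) 𝓘(ℂ, V) ω G c₀ := hC.contMDiffAt_coneVec η ℓ hc₀
  have hpc : ContMDiffAt 𝓘(ℂ, B) 𝓘(ℂ, E) ω (fun c : C => φ (proj C c)) c₀ :=
    ContMDiffAt.comp c₀ (contMDiffAt_extChartAt (x := x₀)) hC.contMDiff_proj.contMDiffAt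
  have hφinv := isInvertible_mfderiv_extChartAt (I := 𝓘(ℂ, E)) (mem_extChartAt_source x₀)
  have hpd : mfderiv 𝓘(ℂ, B) 𝓘(ℂ, E) (fun c : C => φ (proj C c)) c₀ =
      (mfderiv 𝓘(ℂ, E) 𝓘(ℂ, E) φ x₀).comp (mfderiv 𝓘(ℂ, B) 𝓘(ℂ, E) (proj C) c₀) :=
    mfderiv_comp c₀ (mdifferentiableAt_extChartAt (mem_chart_source E x₀))
      (hC.contMDiff_proj.mdifferentiable (by simp) c₀)
  set a : B →L[ℂ] E := mfderiv 𝓘(ℂ, B) 𝓘(ℂ, E) (fun c : C => φ (proj C c)) c₀ with ha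
  set b : B →L[ℂ] V := mfderiv 𝓘(ℂ, B) 𝓘(ℂ, V) G c₀ with hb
  have hasurj : Function.Surjective a := by
    intro e
    obtain ⟨e', he'⟩ := hφinv.surjective e
    obtain ⟨h, hh⟩ := hC.mfderiv_proj_surjective c₀ e'
    exact ⟨h, (DFunLike.congr_fun hpd h).trans
      ((congrArg (mfderiv 𝓘(ℂ, E) 𝓘(ℂ, E) φ x₀) hh).trans he')⟩
  have hab : ∀ h, a h = 0 → b h = 0 → h = 0 := by
    intro h hah hbh
    have h1 : mfderiv 𝓘(ℂ, B) 𝓘(ℂ, E) (proj C) c₀ h = 0 := by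
      refine hφinv.injective (Eq.trans ?_ (map_zero _).symm)
      exact (DFunLike.congr_fun hpd h).symm.trans hah
    refine hC.mfderiv_val_injective c₀ (Eq.trans (η.projTangent_tangent_ext ℓ hc₀ (ζ := 0) ?_ ?_)
      (map_zero _).symm)
    · exact ((hC.mfderiv_base_val c₀ h).trans h1).trans (map_zero _).symm
    · exact ((hC.mfderiv_coneVec_val η ℓ hc₀ h).trans hbh).trans (map_zero _).symm
  obtain ⟨L, hL⟩ := exists_complementary_projection a b hasurj hab
  set κ : C → E × a.ker := coneCoord (C := C) η ℓ L x₀ with hκ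
  have hκc : ContMDiffAt 𝓘(ℂ, B) 𝓘(ℂ, E × a.ker) ω κ c₀ :=
    hpc.prodMk_space (ContMDiffAt.comp c₀ L.contMDiff.contMDiffAt hGc)
  have hκinv : (mfderiv 𝓘(ℂ, B) 𝓘(ℂ, E × a.ker) κ c₀).IsInvertible := by
    have hκd := hκc.mdifferentiableAt (by simp)
    have hLb : mfderiv 𝓘(ℂ, B) 𝓘(ℂ, a.ker) (L ∘ G) c₀ = L.comp b := by
      have h1 : mfderiv 𝓘(ℂ, B) 𝓘(ℂ, a.ker) (L ∘ G) c₀ = _ :=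
        mfderiv_comp c₀ (L.mdifferentiableAt (x := G c₀)) (hGc.mdifferentiableAt (by simp))
      rw [ContinuousLinearMap.mfderiv_eq] at h1
      exact h1
    set D : B →L[ℂ] E × a.ker := mfderiv 𝓘(ℂ, B) 𝓘(ℂ, E × a.ker) κ c₀ with hD
    have hDab : ⇑D = fun h => (a h, L (b h)) := by
      funext h
      exact Prod.ext (mfderiv_fst_apply hκd h).symm
        ((mfderiv_snd_apply hκd h).symm.trans (DFunLike.congr_fun hLb h))
    have hDbij : Function.Bijective D.toLinearMap := by
      change Function.Bijective D
      rw [hDab]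
      exact hL
    exact ⟨(LinearEquiv.ofBijective D.toLinearMap hDbij).toContinuousLinearEquiv,
      ContinuousLinearMap.ext fun _ => rfl⟩
  obtain ⟨R, hR, hRc, hRκ, hinv⟩ := exists_local_inverse hκc hκinv
  have hj : ContMDiffAt 𝓘(ℂ, a.ker) 𝓘(ℂ, B) ω (fun y => R (φ x₀, y)) (L (G c₀)) :=
    ContMDiffAt.comp (L (G c₀)) (f := fun y => (φ x₀, y)) hR
      (contDiff_const.prodMk contDiff_id).contMDiff.contMDiffAt
  -- points of the cone over `Z` near the given one come from points of the fibre over `x₀`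
  have hz : ∀ᶠ z in 𝓝 (G c₀), z ∈ affineCone Z → ℓ z = 1 → G (R (φ x₀, L z)) = z := by
    have h1 : ∀ᶠ q in 𝓝 c₀.1, ∀ hq : q ∈ C, R (κ ⟨q, hq⟩) = ⟨q, hq⟩ := by
      rw [nhds_subtype, Filter.eventually_comap] at hRκ
      filter_upwards [hRκ] with q hq hqC
      exact hq ⟨q, hqC⟩ rfl
    have h2 : ContinuousAt (fun z => ofVector c₀.1 (η.lift (x₀, z))) (G c₀) :=
      ContinuousAt.comp (f := fun z => (x₀, z)) (η.contMDiffAt_ofVector_lift c₀.1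
        (z := (x₀, G c₀)) hc₀).continuousAt (by fun_prop)
    have h3 : ofVector c₀.1 (η.lift (x₀, G c₀)) = c₀.1 := η.ofVector_lift_coneVec ℓ c₀.1 hc₀
    rw [← h3] at h1
    filter_upwards [h2.eventually h1] with z hz hzZ hzℓ
    have hz0 : z ≠ 0 := fun h => by simp [h] at hzℓ
    have hmem := hη.ofVector_lift_mem c₀.1 (z := (x₀, z)) hzZ hz0
    have h4 := hz hmem
    have h5 : G ⟨_, hmem⟩ = z := η.coneVec_ofVector_lift ℓ c₀.1 hzℓ
    have h6 : κ ⟨_, hmem⟩ = (φ x₀, L z) := by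
      refine Prod.ext ?_ (congrArg L h5)
      exact congrArg φ (base_ofVector c₀.1 _ (η.lift_snd_ne_zero (z := (x₀, z)) hz0))
    rw [h6] at h4
    rw [h4, h5]
  refine ⟨a.ker, L, fun y => G (R (φ x₀, y)), hκc, hinv, ?_,
    fun y => hη.coneVec_mem ℓ (R _).2, ?_, hz⟩
  · rw [← contMDiffAt_iff_contDiffAt]
    refine ContMDiffAt.comp (L (G c₀)) (g := G) ?_ hj
    have : R (φ x₀, L (G c₀)) = c₀ := hRc
    rw [this]
    exact hGc
  · filter_upwards [hGc.continuousAt.eventually hz, hGc.continuousAt.eventually_ne hc₀] with c h1 h2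
    exact h1 (hη.coneVec_mem ℓ c.2) (η.apply_coneVec ℓ h2)

end LocalStructure

/-! ### Horizontal fields and their brackets -/

section HorizontalFields

variable {E M V F : Type*} [NormedAddCommGroup E] [NormedSpace ℂ E] [FiniteDimensional ℂ E]
  [TopologicalSpace M] [ChartedSpace E M] [IsManifold 𝓘(ℂ, E) ω M]
  [NormedAddCommGroup V] [NormedSpace ℂ V] [NormedAddCommGroup F] [NormedSpace ℂ F]

/-- In coordinates on `M × F`, the horizontal vector field on which the coframe takes the value
`a(y)` at `(x, y)`. -/
noncomputable def Coframe.horizontalField (η : Coframe E M V) (x₀ : M) (a : F → V) (z : E × F) :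
    E × F :=
  ((η.coord x₀ z.1).inverse (a z.2), 0)

/-- The derivative of `N⁻¹` is `-N⁻¹ N' N⁻¹`, for the coframe `N` in coordinates. -/
lemma Coframe.fderiv_inverse_coord (η : Coframe E M V) {x₀ : M} {e : E}
    (he : e ∈ (extChartAt 𝓘(ℂ, E) x₀).target) (h : E) (v : V) :
    fderiv ℂ (fun y => (η.coord x₀ y).inverse) e h v =
      -(η.coord x₀ e).inverse (fderiv ℂ (η.coord x₀) e h ((η.coord x₀ e).inverse v)) := by
  have hN : DifferentiableAt ℂ (η.coord x₀) e := (η.contDiffAt_coord he).differentiableAt (by simp)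
  have hD : DifferentiableAt ℂ (fun y => (η.coord x₀ y).inverse) e :=
    (η.contDiffAt_inverse_coord he).differentiableAt (by simp)
  have hDv : DifferentiableAt ℂ (fun y => (η.coord x₀ y).inverse v) e :=
    hD.clm_apply (differentiableAt_const v)
  have hDv' : fderiv ℂ (fun y => (η.coord x₀ y).inverse v) e h =
      fderiv ℂ (fun y => (η.coord x₀ y).inverse) e h v := by
    rw [fderiv_clm_apply hD (differentiableAt_const v)]
    simp
  have hconst : (fun y => η.coord x₀ y ((η.coord x₀ y).inverse v)) =ᶠ[𝓝 e] fun _ => v := by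
    filter_upwards [(isOpen_extChartAt_target x₀).mem_nhds he] with y hy
    exact (η.coord_isInvertible hy).self_apply_inverse v
  have h1 : fderiv ℂ (fun y => η.coord x₀ y ((η.coord x₀ y).inverse v)) e h =
      fderiv ℂ (fun _ => v) e h := by rw [hconst.fderiv_eq]
  rw [fderiv_clm_apply hN hDv] at h1
  simp only [add_apply, ContinuousLinearMap.comp_apply,
    ContinuousLinearMap.flip_apply, hDv', fderiv_const_apply,
    zero_apply] at h1
  have h2 := congrArg (η.coord x₀ e).inverse h1
  rw [map_add, (η.coord_isInvertible he).inverse_apply_self, map_zero] at h2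
  exact eq_neg_of_add_eq_zero_left h2

lemma Coframe.contDiffAt_horizontalField (η : Coframe E M V) {x₀ : M} {a : F → V} {z : E × F}
    (hz : z.1 ∈ (extChartAt 𝓘(ℂ, E) x₀).target) (ha : ContDiffAt ℂ ω a z.2) :
    ContDiffAt ℂ ω (η.horizontalField x₀ a) z :=
  (((η.contDiffAt_inverse_coord hz).comp z contDiffAt_fst).clm_apply
    (ha.comp z contDiffAt_snd)).prodMk contDiffAt_const

lemma Coframe.fderiv_horizontalField (η : Coframe E M V) {x₀ : M} {a : F → V} {z : E × F}
    (hz : z.1 ∈ (extChartAt 𝓘(ℂ, E) x₀).target) (ha : ContDiffAt ℂ ω a z.2) (h : E) :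
    (fderiv ℂ (η.horizontalField x₀ a) z (h, 0)).1 =
      fderiv ℂ (fun y => (η.coord x₀ y).inverse) z.1 h (a z.2) := by
  have hD : DifferentiableAt ℂ (fun y => (η.coord x₀ y).inverse) z.1 :=
    (η.contDiffAt_inverse_coord hz).differentiableAt (by simp)
  have hDz : HasFDerivAt (fun z : E × F => (η.coord x₀ z.1).inverse) _ z :=
    hD.hasFDerivAt.comp z hasFDerivAt_fst
  have haz : HasFDerivAt (fun z : E × F => a z.2) _ z :=
    (ha.differentiableAt (by simp)).hasFDerivAt.comp z hasFDerivAt_snd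
  have h1 : HasFDerivAt (η.horizontalField x₀ a) _ z :=
    (hDz.clm_apply haz).prodMk (hasFDerivAt_const 0 z)
  rw [h1.fderiv]
  simp

/-- The bracket of two horizontal fields is given by the structure function: the part of the
bracket tangent to `M` is dual to the exterior derivative of the coframe. -/
lemma Coframe.lieBracket_horizontalField (η : Coframe E M V) {x₀ : M} {a b : F → V} {y : F}
    (ha : ContDiffAt ℂ ω a y) (hb : ContDiffAt ℂ ω b y) :
    (lieBracket ℂ (η.horizontalField x₀ a) (η.horizontalField x₀ b)
      (extChartAt 𝓘(ℂ, E) x₀ x₀, y)).1 =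
      (η.coord x₀ (extChartAt 𝓘(ℂ, E) x₀ x₀)).inverse
        ((2 : ℂ) • η.structureFunction x₀ ![b y, a y]) := by
  have he : extChartAt 𝓘(ℂ, E) x₀ x₀ ∈ (extChartAt 𝓘(ℂ, E) x₀).target := mem_extChartAt_target x₀
  have hinv := η.coord_isInvertible he
  have hσ := η.structureFunction_coord x₀
    ((η.coord x₀ (extChartAt 𝓘(ℂ, E) x₀ x₀)).inverse (b y))
    ((η.coord x₀ (extChartAt 𝓘(ℂ, E) x₀ x₀)).inverse (a y))
  rw [hinv.self_apply_inverse, hinv.self_apply_inverse] at hσ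
  have h1 := η.fderiv_horizontalField (z := (extChartAt 𝓘(ℂ, E) x₀ x₀, y)) he hb
    ((η.coord x₀ (extChartAt 𝓘(ℂ, E) x₀ x₀)).inverse (a y))
  have h2 := η.fderiv_horizontalField (z := (extChartAt 𝓘(ℂ, E) x₀ x₀, y)) he ha
    ((η.coord x₀ (extChartAt 𝓘(ℂ, E) x₀ x₀)).inverse (b y))
  rw [η.fderiv_inverse_coord he] at h1 h2
  rw [hσ, smul_smul, show (2 : ℂ) * (1 / 2) = 1 by norm_num, one_smul, map_sub, lieBracket_eq,
    Prod.fst_sub]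
  refine (congrArg₂ (· - ·) h1 h2).trans ?_
  abel

end HorizontalFields

section Main

variable {E M V B F : Type*} [NormedAddCommGroup E] [NormedSpace ℂ E] [FiniteDimensional ℂ E]
  [TopologicalSpace M] [ChartedSpace E M] [IsManifold 𝓘(ℂ, E) ω M]
  [NormedAddCommGroup V] [NormedSpace ℂ V]
  [NormedAddCommGroup B] [NormedSpace ℂ B] [NormedAddCommGroup F] [NormedSpace ℂ F]
  {C : Set (ProjTangentBundle E M)} [ChartedSpace B C] [IsManifold 𝓘(ℂ, B) ω C]
  {Z : Set (ℙ ℂ V)} {η : Coframe E M V} {ℓ : V →L[ℂ] ℂ} {L : V →L[ℂ] F} {x₀ : M}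

/-- In the coordinates `coneCoord`, the base component of a tangent vector of `C` determines the
value of the coframe on its projection to `M`. -/
lemma IsConeStructure.mfderiv_proj_eq (hC : IsConeStructure (B := B) C) {c : C}
    (hc : proj C c ∈ (extChartAt 𝓘(ℂ, E) x₀).source)
    (hκ : MDifferentiableAt 𝓘(ℂ, B) 𝓘(ℂ, E × F) (coneCoord (C := C) η ℓ L x₀) c)
    (ξ : TangentSpace 𝓘(ℂ, B) c) (u : V)
    (h : Prod.fst (α := E) (β := F)
      (mfderiv 𝓘(ℂ, B) 𝓘(ℂ, E × F) (coneCoord (C := C) η ℓ L x₀) c ξ) =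
      (η.coord x₀ (extChartAt 𝓘(ℂ, E) x₀ (proj C c))).inverse u) :
    mfderiv 𝓘(ℂ, B) 𝓘(ℂ, E) (proj C) c ξ = (η.toEquiv (proj C c)).symm u := by
  have hc' : proj C c ∈ (chartAt E x₀).source := by rwa [← extChartAt_source 𝓘(ℂ, E)]
  have h1 : mfderiv 𝓘(ℂ, B) 𝓘(ℂ, E) (fun c : C => extChartAt 𝓘(ℂ, E) x₀ (proj C c)) c =
      (mfderiv 𝓘(ℂ, E) 𝓘(ℂ, E) (extChartAt 𝓘(ℂ, E) x₀) (proj C c)).comp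
        (mfderiv 𝓘(ℂ, B) 𝓘(ℂ, E) (proj C) c) :=
    mfderiv_comp c (mdifferentiableAt_extChartAt hc')
      (hC.contMDiff_proj.mdifferentiable (by simp) c)
  refine (isInvertible_mfderiv_extChartAt hc).injective ?_
  exact ((DFunLike.congr_fun h1 ξ).symm.trans (mfderiv_fst_apply hκ ξ)).trans
    (h.trans (η.coord_inverse_apply hc u))

/-- A tangent vector of `C` on which the coframe takes the value `G(c)` and that does not move `G`,
where `G(c)` is the normalized vector of the cone, lies in the distribution `Γ`: the image of the
geodesic flow in `ℙ T(M)` has these same two velocities. -/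
lemma IsConeStructure.mem_Gamma (hC : IsConeStructure (B := B) C) {c : C}
    (hc : η.coneVec ℓ c.1 ≠ 0) {ξ : TangentSpace 𝓘(ℂ, B) c}
    (hbase : mfderiv 𝓘(ℂ, B) 𝓘(ℂ, E) (proj C) c ξ =
      (η.toEquiv (proj C c)).symm (η.coneVec ℓ c.1))
    (hcone : mfderiv 𝓘(ℂ, B) 𝓘(ℂ, V) (fun c : C => η.coneVec ℓ c.1) c ξ = 0) :
    ξ ∈ Gamma (B := B) C η c := by
  set u : TangentSpace 𝓘(ℂ, E) c.1.base := (η.toEquiv c.1.base).symm (η.coneVec ℓ c.1) with hu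
  have hu0 : u ≠ 0 := η.lift_snd_ne_zero (z := (c.1.base, η.coneVec ℓ c.1)) hc
  have hlift : ofVector c.1 ⟨c.1.base, u⟩ = c.1 := η.ofVector_lift_coneVec ℓ c.1 hc
  set v : TangentBundle 𝓘(ℂ, E) M := ⟨c.1.base, u⟩ with hv
  have hline : Projectivization.mk ℂ u hu0 = c.1.line := by
    have h1 : (⟨c.1.base, Projectivization.mk ℂ u hu0⟩ : ProjTangentBundle E M) =
        ⟨c.1.base, c.1.line⟩ := by
      rw [ofVector, dif_pos hu0] at hlift
      exact hlift
    rw [ProjTangentBundle.mk.injEq] at h1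
    exact h1.2
  have hof : MDifferentiableAt 𝓘(ℂ, E).tangent 𝓘(ℂ, E × AffineModel E) (ofVector c.1) v :=
    (contMDiffAt_ofVector c.1 v hu0).mdifferentiableAt (by simp)
  have hc' : η.coneVec ℓ (ofVector c.1 v) ≠ 0 := by rwa [hlift]
  have hbase' : mfderiv 𝓘(ℂ, E × AffineModel E) 𝓘(ℂ, E)
      (ProjTangentBundle.base : ProjTangentBundle E M → M) (ofVector c.1 v)
      (mfderiv 𝓘(ℂ, E).tangent 𝓘(ℂ, E × AffineModel E) (ofVector c.1) v (η.geodesicFlow v)) =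
      u := by
    have h1 := mfderiv_comp v ((contMDiffAt_base (ofVector c.1 v)).mdifferentiableAt (by simp)) hof
    have h2 : (ProjTangentBundle.base : ProjTangentBundle E M → M) ∘ ofVector c.1 =ᶠ[𝓝 v]
        fun v => v.1 := by
      filter_upwards [eventually_snd_ne_zero v hu0] with v' hv'
      exact base_ofVector c.1 v' hv'
    exact (DFunLike.congr_fun (h1.symm.trans h2.mfderiv_eq) _).trans (η.mfderiv_proj_geodesicFlow v)
  have hcone' : mfderiv 𝓘(ℂ, E × AffineModel E) 𝓘(ℂ, V) (η.coneVec ℓ) (ofVector c.1 v)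
      (mfderiv 𝓘(ℂ, E).tangent 𝓘(ℂ, E × AffineModel E) (ofVector c.1) v (η.geodesicFlow v)) =
      0 := by
    have h1 := mfderiv_comp v ((η.contMDiffAt_coneVec ℓ hc').mdifferentiableAt (by simp)) hof
    have h2 : η.coneVec ℓ ∘ ofVector c.1 =ᶠ[𝓝 v] (fun v => (ℓ v)⁻¹ • v) ∘ η.mu := by
      filter_upwards [eventually_snd_ne_zero v hu0] with v' hv'
      exact η.coneVec_ofVector ℓ c.1 hv'
    have hℓ : ℓ (η.mu v) ≠ 0 := by
      rw [η.coneVec_ofVector ℓ c.1 hu0] at hc'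
      exact inv_eq_zero.not.1 (left_ne_zero_of_smul hc')
    have h3 := mfderiv_comp v ((Coframe.contMDiffAt_normalize ℓ hℓ).mdifferentiableAt (by simp))
      (η.holomorphic.mdifferentiable (by simp) v : MDifferentiableAt _ _ η.mu v)
    refine (DFunLike.congr_fun (h1.symm.trans (h2.mfderiv_eq.trans h3)) _).trans ?_
    exact (congrArg (mfderiv 𝓘(ℂ, V) 𝓘(ℂ, V) (fun v => (ℓ v)⁻¹ • v) (η.mu v))
      (η.mfderiv_mu_geodesicFlow v)).trans (map_zero _)
  refine Submodule.subset_span ⟨u, hu0, hline, η.projTangent_tangent_ext ℓ hc ?_ ?_⟩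
  · refine ((hC.mfderiv_base_val c ξ).trans hbase).trans (hbase'.symm.trans ?_)
    exact congrArg (fun p => (mfderiv 𝓘(ℂ, E × AffineModel E) 𝓘(ℂ, E)
      (ProjTangentBundle.base : ProjTangentBundle E M → M) p : E × AffineModel E →L[ℂ] E)
      (mfderiv 𝓘(ℂ, E).tangent 𝓘(ℂ, E × AffineModel E) (ofVector c.1) v (η.geodesicFlow v))) hlift
  · refine ((hC.mfderiv_coneVec_val η ℓ hc ξ).trans hcone).trans (hcone'.symm.trans ?_)
    exact congrArg (fun p => (mfderiv 𝓘(ℂ, E × AffineModel E) 𝓘(ℂ, V) (η.coneVec ℓ) p :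
      E × AffineModel E →L[ℂ] V)
      (mfderiv 𝓘(ℂ, E).tangent 𝓘(ℂ, E × AffineModel E) (ofVector c.1) v (η.geodesicFlow v))) hlift

end Main

/-! ### The structure function on the cone -/

section ConeVelocities

variable {E M V F : Type*} [NormedAddCommGroup E] [NormedSpace ℂ E]
  [TopologicalSpace M] [ChartedSpace E M] [IsManifold 𝓘(ℂ, E) ω M]
  [NormedAddCommGroup V] [NormedSpace ℂ V]
  [NormedAddCommGroup F] [NormedSpace ℂ F] {Z : Set (ℙ ℂ V)}

/-- The normalized vector lies on the line of `V` that the coframe assigns to `p`. -/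
lemma coneVec_mem_submodule (η : Coframe E M V) (ℓ : V →L[ℂ] ℂ) (p : ProjTangentBundle E M) :
    η.coneVec ℓ p ∈ (Projectivization.map (η.toEquiv p.base).toLinearEquiv.toLinearMap
      (η.toEquiv p.base).injective p.line).submodule := by
  have h : Projectivization.map (η.toEquiv p.base).toLinearEquiv.toLinearMap
      (η.toEquiv p.base).injective p.line = Projectivization.mk ℂ (η.toEquiv p.base p.line.rep)
        (fun h => p.line.rep_nonzero ((map_eq_zero_iff _ (η.toEquiv p.base).injective).1 h)) := by
    conv_lhs => rw [← p.line.mk_rep]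
    rfl
  rw [h, Projectivization.submodule_mk]
  exact Submodule.smul_mem _ _ (Submodule.mem_span_singleton_self _)

/-- The velocities of a parametrization of the cone over `Z` are tangent to that cone. -/
lemma fderiv_mem_affineTangentSpace {g : F → V} {y : F} (hg : ContDiffAt ℂ ω g y)
    (hgZ : ∀ y, g y ∈ affineCone Z) {α : ℙ ℂ V} (hy : g y ≠ 0) (hα : g y ∈ α.submodule) (ν : F) :
    fderiv ℂ g y ν ∈ affineTangentSpace Z α := by
  have hline : ContDiff ℂ ω (fun τ : ℂ => y + τ • ν) :=
    contDiff_const.add (contDiff_id.smul contDiff_const)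
  have h0 : y + (0 : ℂ) • ν = y := by simp
  have hcomp : ContDiffAt ℂ ω (fun τ : ℂ => g (y + τ • ν)) 0 :=
    ContDiffAt.comp (0 : ℂ) (g := g) (by rwa [h0]) hline.contDiffAt
  refine Submodule.subset_span ⟨fun τ => g (y + τ • ν), by simpa using hy, by simpa using hα,
    ?_, ?_⟩
  · filter_upwards [hcomp.eventually (by simp)] with τ hτ
    exact ⟨hτ.differentiableAt (by simp), hgZ _⟩
  · have h1 : HasDerivAt (fun τ : ℂ => y + τ • ν) ν 0 := by
      simpa using ((hasDerivAt_id (0 : ℂ)).smul_const ν).const_add y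
    have h2 : HasFDerivAt g (fderiv ℂ g y) (y + (0 : ℂ) • ν) := by
      rw [h0]
      exact (hg.differentiableAt (by simp)).hasFDerivAt
    exact h2.comp_hasDerivAt (0 : ℂ) h1

/-- A velocity of the cone, at the multiple `b • s` of a point `s` with `ℓ s = 1`, is a velocity of
the slice `ℓ = 1` up to scaling and up to a multiple of `s`. -/
lemma velocity_eq_of_slice {L : V →L[ℂ] F} {ℓ : V →L[ℂ] ℂ} {g : F → V} {s : V}
    (hg : ContDiffAt ℂ ω g (L s))
    (hgs : ∀ᶠ z in 𝓝 s, z ∈ affineCone Z → ℓ z = 1 → g (L z) = z) (hs : ℓ s = 1)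
    {c : ℂ → V} {w : V} {b : ℂ} (hb : b ≠ 0) (hc0 : c 0 = b • s)
    (hcZ : ∀ᶠ t in 𝓝 (0 : ℂ), c t ∈ affineCone Z) (hc : HasDerivAt c w 0) :
    ∃ ν : F, w = fderiv ℂ g (L s) ν + ℓ w • s := by
  have hℓ0 : ℓ (c 0) = b := by rw [hc0, map_smul, hs, smul_eq_mul, mul_one]
  set d : ℂ → V := fun t => (ℓ (c t))⁻¹ • c t with hd
  have hd0 : d 0 = s := by
    rw [hd]
    simp only [hℓ0]
    rw [hc0, smul_smul, inv_mul_cancel₀ hb, one_smul]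
  have hℓc : HasDerivAt (fun t => ℓ (c t)) (ℓ w) 0 := ℓ.hasFDerivAt.comp_hasDerivAt (0 : ℂ) hc
  have hℓne : ℓ (c 0) ≠ 0 := by rwa [hℓ0]
  have hd' : HasDerivAt d (deriv d 0) 0 :=
    ((hℓc.inv hℓne).smul hc).differentiableAt.hasDerivAt
  have hgd : g ∘ (fun t => L (d t)) =ᶠ[𝓝 0] d := by
    have h1 : ∀ᶠ t in 𝓝 (0 : ℂ), d t ∈ affineCone Z → ℓ (d t) = 1 → g (L (d t)) = d t :=
      hd'.continuousAt.eventually (by rwa [hd0])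
    filter_upwards [h1, hcZ, hℓc.continuousAt.eventually_ne hℓne] with t ht htZ htℓ
    refine ht (smul_mem_affineCone htZ _) ?_
    rw [hd]
    simp only [map_smul, smul_eq_mul, inv_mul_cancel₀ htℓ]
  have hLd : HasDerivAt (fun t => L (d t)) (L (deriv d 0)) 0 :=
    L.hasFDerivAt.comp_hasDerivAt (0 : ℂ) hd'
  have hgd' : HasDerivAt (g ∘ fun t => L (d t)) (fderiv ℂ g (L s) (L (deriv d 0))) 0 := by
    refine HasFDerivAt.comp_hasDerivAt (0 : ℂ) ?_ hLd
    rw [hd0]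
    exact (hg.differentiableAt (by simp)).hasFDerivAt
  have h2 : fderiv ℂ g (L s) (L (deriv d 0)) = deriv d 0 :=
    hgd'.unique (hd'.congr_of_eventuallyEq hgd)
  have hcd : (fun t => ℓ (c t) • d t) =ᶠ[𝓝 0] c := by
    filter_upwards [hℓc.continuousAt.eventually_ne hℓne] with t htℓ
    rw [hd]
    simp only [smul_smul, mul_inv_cancel₀ htℓ, one_smul]
  have h3 : w = b • deriv d 0 + ℓ w • s := by
    have h4 := hc.unique ((hℓc.smul hd').congr_of_eventuallyEq hcd.symm)
    rwa [hd0, hℓ0] at h4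
  exact ⟨b • L (deriv d 0), by rw [map_smul, h2, ← h3]⟩

end ConeVelocities

section LocalBracket

variable {E M V B F : Type*} [NormedAddCommGroup E] [NormedSpace ℂ E] [FiniteDimensional ℂ E]
  [TopologicalSpace M] [ChartedSpace E M] [IsManifold 𝓘(ℂ, E) ω M]
  [NormedAddCommGroup V] [NormedSpace ℂ V]
  [NormedAddCommGroup B] [NormedSpace ℂ B] [FiniteDimensional ℂ B]
  [NormedAddCommGroup F] [NormedSpace ℂ F]
  {C : Set (ProjTangentBundle E M)} [ChartedSpace B C] [IsManifold 𝓘(ℂ, B) ω C]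
  {Z : Set (ℙ ℂ V)} {η : Coframe E M V} {ℓ : V →L[ℂ] ℂ} {L : V →L[ℂ] F}

/-- If `Γ` is characteristic, then the structure function maps a point of the cone and a velocity
of the cone to a tangent vector of the cone. The sections of `P` and `Γ` whose bracket shows this
are horizontal fields in coordinates adapted to the coframe. -/
theorem structureFunction_mem_of_coordinates (hC : IsConeStructure (B := B) C)
    (hη : IsAdapted Z C η) (hΓ : IsCharacteristic (Gamma (B := B) C η)) {c₀ : C}
    (hc₀ : η.coneVec ℓ c₀.1 ≠ 0) {g : F → V}
    (hκ : ContMDiffAt 𝓘(ℂ, B) 𝓘(ℂ, E × F) ω (coneCoord (C := C) η ℓ L (proj C c₀)) c₀)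
    (hinv : ∀ᶠ c in 𝓝 c₀, (mfderiv 𝓘(ℂ, B) 𝓘(ℂ, E × F)
      (coneCoord (C := C) η ℓ L (proj C c₀)) c).IsInvertible)
    (hg : ContDiffAt ℂ ω g (L (η.coneVec ℓ c₀.1))) (hgZ : ∀ y, g y ∈ affineCone Z)
    (hgL : ∀ᶠ c : C in 𝓝 c₀, g (L (η.coneVec ℓ c.1)) = η.coneVec ℓ c.1) (ν : F) :
    η.structureFunction (proj C c₀)
        ![η.coneVec ℓ c₀.1, fderiv ℂ g (L (η.coneVec ℓ c₀.1)) ν] ∈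
      affineTangentSpace Z (Projectivization.map
        (η.toEquiv (proj C c₀)).toLinearEquiv.toLinearMap (η.toEquiv (proj C c₀)).injective
          c₀.1.line) := by
  have : CompleteSpace B := FiniteDimensional.complete ℂ B
  have : CompleteSpace E := FiniteDimensional.complete ℂ E
  have : IsManifold 𝓘(ℂ, B) (minSmoothness ℂ 3) C := IsManifold.of_le (n := ω) (by simp)
  set x₀ := proj C c₀ with hx₀
  set κ : C → E × F := coneCoord (C := C) η ℓ L x₀ with hκdef
  set b : F → V := fun y => fderiv ℂ g y ν with hb
  -- `w` is a section of `Γ`: its value under the coframe is the point of the cone, which it fixes;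
  -- `v` is a section of `P`: its value under the coframe is a velocity of the cone at that point
  set w : ∀ c : C, TangentSpace 𝓘(ℂ, B) c :=
    mpullback 𝓘(ℂ, B) 𝓘(ℂ, E × F) κ (η.horizontalField x₀ g) with hw
  set v : ∀ c : C, TangentSpace 𝓘(ℂ, B) c :=
    mpullback 𝓘(ℂ, B) 𝓘(ℂ, E × F) κ (η.horizontalField x₀ b) with hv
  have hGc : ContinuousAt (fun c : C => η.coneVec ℓ c.1) c₀ :=
    (hC.contMDiffAt_coneVec η ℓ hc₀).continuousAt
  have hproj : ∀ᶠ c in 𝓝 c₀, proj C c ∈ (extChartAt 𝓘(ℂ, E) x₀).source :=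
    hC.contMDiff_proj.continuous.continuousAt.eventually
      ((isOpen_extChartAt_source x₀).mem_nhds (mem_extChartAt_source x₀))
  have hg' : ∀ᶠ c : C in 𝓝 c₀, ContDiffAt ℂ ω g (L (η.coneVec ℓ c.1)) :=
    (L.continuous.continuousAt.comp hGc).eventually (hg.eventually (by simp))
  have hκ' : ∀ᶠ c in 𝓝 c₀, ContMDiffAt 𝓘(ℂ, B) 𝓘(ℂ, E × F) ω κ c :=
    (contMDiffAt_iff_contMDiffAt_nhds (by simp)).1 hκ
  obtain ⟨U, hU, hUo, hcU⟩ := eventually_nhds_iff.1 (((((hproj.and hκ').and hinv).and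
    (hGc.eventually_ne hc₀)).and hgL.eventually_nhds).and hg')
  have hb' : ∀ {y}, ContDiffAt ℂ ω g y → ContDiffAt ℂ ω b y := fun h =>
    (h.fderiv_right (m := ω) le_rfl).clm_apply contDiffAt_const
  have hpush : ∀ c ∈ U, ∀ a : F → V, mfderiv 𝓘(ℂ, B) 𝓘(ℂ, E × F) κ c
      (mpullback 𝓘(ℂ, B) 𝓘(ℂ, E × F) κ (η.horizontalField x₀ a) c) =
      η.horizontalField x₀ a (κ c) := fun c hc a =>
    (hU c hc).1.1.1.2.self_apply_inverse _
  have htarget : ∀ c ∈ U, (κ c).1 ∈ (extChartAt 𝓘(ℂ, E) x₀).target := fun c hc =>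
    (extChartAt 𝓘(ℂ, E) x₀).map_source (hU c hc).1.1.1.1.1
  have hsmooth : ∀ c ∈ U, ∀ a : F → V, ContDiffAt ℂ ω a (L (η.coneVec ℓ c.1)) →
      ContMDiffAt 𝓘(ℂ, B) 𝓘(ℂ, B).tangent ω (fun c =>
        (⟨c, mpullback 𝓘(ℂ, B) 𝓘(ℂ, E × F) κ (η.horizontalField x₀ a) c⟩ :
          TangentBundle 𝓘(ℂ, B) C)) c := fun c hc a ha =>
    ContMDiffAt.mpullback_vectorField_preimage
      (contMDiffAt_vectorSpace_iff_contDiffAt.2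
        (η.contDiffAt_horizontalField (htarget c hc) ha)) (hU c hc).1.1.1.1.2
      (hU c hc).1.1.1.2 le_rfl
  have hprojv : ∀ c ∈ U, ∀ a : F → V, mfderiv 𝓘(ℂ, B) 𝓘(ℂ, E) (proj C) c
      (mpullback 𝓘(ℂ, B) 𝓘(ℂ, E × F) κ (η.horizontalField x₀ a) c) =
      (η.toEquiv (proj C c)).symm (a (L (η.coneVec ℓ c.1))) := fun c hc a =>
    hC.mfderiv_proj_eq (hU c hc).1.1.1.1.1 ((hU c hc).1.1.1.1.2.mdifferentiableAt (by simp)) _ _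
      (congrArg (Prod.fst (α := E) (β := F)) (hpush c hc a))
  have hvP : IsLocalSection (distributionP C) U v := by
    refine ⟨hUo, fun c hc => (hsmooth c hc b (hb' (hU c hc).2)).contMDiffWithinAt, fun c hc => ?_⟩
    refine (hη.mem_affineTangentSpace_iff _ _ _).2 ?_
    have h1 : η.toEquiv (proj C c) (mfderiv 𝓘(ℂ, B) 𝓘(ℂ, E) (proj C) c (v c)) =
        b (L (η.coneVec ℓ c.1)) :=
      (congrArg (η.toEquiv (proj C c)) (hprojv c hc b)).trans
        ((η.toEquiv (proj C c)).apply_symm_apply _)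
    have h2 : g (L (η.coneVec ℓ c.1)) = η.coneVec ℓ c.1 := (hU c hc).1.2.self_of_nhds
    have h3 : b (L (η.coneVec ℓ c.1)) ∈ affineTangentSpace Z (Projectivization.map
        (η.toEquiv (proj C c)).toLinearEquiv.toLinearMap (η.toEquiv (proj C c)).injective
          c.1.line) :=
      fderiv_mem_affineTangentSpace (hU c hc).2 hgZ (by rw [h2]; exact (hU c hc).1.1.2)
        (by rw [h2]; exact coneVec_mem_submodule η ℓ c.1) ν
    rw [← h1] at h3
    exact h3
  have hwΓ : IsLocalSection (Gamma (B := B) C η) U w := by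
    refine ⟨hUo, fun c hc => (hsmooth c hc g (hU c hc).2).contMDiffWithinAt, fun c hc => ?_⟩
    have h2 : g (L (η.coneVec ℓ c.1)) = η.coneVec ℓ c.1 := (hU c hc).1.2.self_of_nhds
    refine hC.mem_Gamma (hU c hc).1.1.2 ((hprojv c hc g).trans (by rw [h2])) ?_
    have h3 : (fun c : C => η.coneVec ℓ c.1) =ᶠ[𝓝 c] g ∘ fun c => (κ c).2 := by
      filter_upwards [(hU c hc).1.2] with c' hc'
      exact hc'.symm
    have hκc := (hU c hc).1.1.1.1.2.mdifferentiableAt (by simp)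
    have hκ2 : MDifferentiableAt 𝓘(ℂ, B) 𝓘(ℂ, F) (fun c => (κ c).2) c :=
      MDifferentiableAt.comp c (g := (ContinuousLinearMap.snd ℂ E F))
        (ContinuousLinearMap.snd ℂ E F).mdifferentiableAt hκc
    have h4 := mfderiv_comp (I' := 𝓘(ℂ, F)) c
      (((hU c hc).2.differentiableAt (by simp)).mdifferentiableAt :
        MDifferentiableAt 𝓘(ℂ, F) 𝓘(ℂ, V) g ((κ c).2)) hκ2
    have h5 : mfderiv 𝓘(ℂ, B) 𝓘(ℂ, F) (fun c => (κ c).2) c (w c) = 0 :=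
      (mfderiv_snd_apply hκc (w c)).trans
        (congrArg (Prod.snd (α := E) (β := F)) (hpush c hc g))
    exact (DFunLike.congr_fun (h3.mfderiv_eq.trans h4) (w c)).trans
      ((congrArg (mfderiv 𝓘(ℂ, F) 𝓘(ℂ, V) g ((κ c).2)) h5).trans (map_zero _))
  have hbr := hΓ U v w hvP hwΓ c₀ hcU
  have hmdiff : ∀ a : F → V, ContDiffAt ℂ ω a (L (η.coneVec ℓ c₀.1)) →
      MDifferentiableAt 𝓘(ℂ, E × F) 𝓘(ℂ, E × F).tangent (fun z =>
        (⟨z, η.horizontalField x₀ a z⟩ : TangentBundle 𝓘(ℂ, E × F) (E × F))) (κ c₀) := fun a ha =>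
    (contMDiffAt_vectorSpace_iff_contDiffAt.2
      (η.contDiffAt_horizontalField (htarget c₀ hcU) ha)).mdifferentiableAt (by simp)
  have hpull := mpullback_mlieBracket (hmdiff b (hb' hg)) (hmdiff g hg) hκ (by simp)
  have hpush' : mfderiv 𝓘(ℂ, B) 𝓘(ℂ, E × F) κ c₀ (mlieBracket 𝓘(ℂ, B) v w c₀) =
      lieBracket ℂ (η.horizontalField x₀ b) (η.horizontalField x₀ g) (κ c₀) := by
    have hlie : mlieBracket 𝓘(ℂ, E × F) (η.horizontalField x₀ b) (η.horizontalField x₀ g) =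
        lieBracket ℂ (η.horizontalField x₀ b) (η.horizontalField x₀ g) :=
      mlieBracketWithin_univ.symm.trans
        (mlieBracketWithin_eq_lieBracketWithin.trans lieBracketWithin_univ)
    rw [hv, hw, ← hpull, mpullback_apply]
    exact ((hU c₀ hcU).1.1.1.2.self_apply_inverse _).trans (congrFun hlie (κ c₀))
  have hfst : Prod.fst (α := E) (β := F)
      (mfderiv 𝓘(ℂ, B) 𝓘(ℂ, E × F) κ c₀ (mlieBracket 𝓘(ℂ, B) v w c₀)) =
      (η.coord x₀ (extChartAt 𝓘(ℂ, E) x₀ x₀)).inverse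
        ((2 : ℂ) • η.structureFunction x₀ ![g (L (η.coneVec ℓ c₀.1)), b (L (η.coneVec ℓ c₀.1))]) :=
    (congrArg (Prod.fst (α := E) (β := F)) hpush').trans
      (η.lieBracket_horizontalField (hb' hg) hg)
  have hdproj := hC.mfderiv_proj_eq (hU c₀ hcU).1.1.1.1.1
    ((hU c₀ hcU).1.1.1.1.2.mdifferentiableAt (by simp)) _ _ hfst
  have hmem := (hη.mem_affineTangentSpace_iff _ _ _).1 hbr
  have h1 := (congrArg (η.toEquiv x₀) hdproj).trans ((η.toEquiv x₀).apply_symm_apply _)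
  have h2 : (2 : ℂ) • η.structureFunction x₀
      ![g (L (η.coneVec ℓ c₀.1)), b (L (η.coneVec ℓ c₀.1))] ∈
      affineTangentSpace Z (Projectivization.map
        (η.toEquiv x₀).toLinearEquiv.toLinearMap (η.toEquiv x₀).injective c₀.1.line) := by
    rw [← h1]
    exact hmem
  rw [(hU c₀ hcU).1.2.self_of_nhds] at h2
  exact (Submodule.smul_mem_iff _ two_ne_zero).1 h2

end LocalBracket

section Main

variable {E M V B : Type*} [NormedAddCommGroup E] [NormedSpace ℂ E] [FiniteDimensional ℂ E]
  [TopologicalSpace M] [ChartedSpace E M] [IsManifold 𝓘(ℂ, E) ω M]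
  [NormedAddCommGroup V] [NormedSpace ℂ V] [FiniteDimensional ℂ V]
  [NormedAddCommGroup B] [NormedSpace ℂ B] [FiniteDimensional ℂ B]
  {C : Set (ProjTangentBundle E M)} [ChartedSpace B C] [IsManifold 𝓘(ℂ, B) ω C]
  {Z : Set (ℙ ℂ V)} {η : Coframe E M V}

/-- If `Γ` is characteristic, then the structure function takes its values in `Ξ_Z`. -/
theorem structureFunction_mem_Xi (hC : IsConeStructure (B := B) C)
    (hη : IsAdapted Z C η) (hΓ : IsCharacteristic (Gamma (B := B) C η)) (x : M) :
    η.structureFunction x ∈ Xi Z := by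
  intro α hα u hu v hv
  have hα' := hα
  rw [← hη x] at hα'
  obtain ⟨l, hl, hlα⟩ := hα'
  set c₀ : C := ⟨⟨x, l⟩, hl⟩ with hc₀def
  have hr0 : η.toEquiv x l.rep ≠ 0 := fun h =>
    l.rep_nonzero ((map_eq_zero_iff _ (η.toEquiv x).injective).1 h)
  obtain ⟨ℓ, hℓ⟩ := SeparatingDual.exists_eq_one (R := ℂ) hr0
  set s : V := η.coneVec ℓ c₀.1 with hs
  have hsr : s = η.toEquiv x l.rep := by
    rw [hs, Coframe.coneVec]
    change (ℓ (η.toEquiv x l.rep))⁻¹ • η.toEquiv x l.rep = _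
    rw [hℓ, inv_one, one_smul]
  have hs0 : s ≠ 0 := by rwa [hsr]
  have hs1 : ℓ s = 1 := by rw [hsr, hℓ]
  have hspan : α.submodule = ℂ ∙ s := by
    rw [← hlα, hsr]
    conv_lhs => rw [← l.mk_rep]
    exact Projectivization.submodule_mk _ _
  obtain ⟨F, L, g, hκ, hinv, hg, hgZ, hgL, hgs⟩ := exists_adapted_coordinates η ℓ hC hη hs0
  have hkey := structureFunction_mem_of_coordinates hC hη hΓ hs0 hκ hinv hg hgZ hgL
  have hkey' : ∀ ν : F, η.structureFunction x ![s, fderiv ℂ g (L s) ν] ∈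
      affineTangentSpace Z α := by
    intro ν
    rw [← hlα]
    exact hkey ν
  rw [hspan] at hu
  obtain ⟨a, rfl⟩ := Submodule.mem_span_singleton.1 hu
  -- the linear map `v ↦ σ(s, v)`
  let T : V →ₗ[ℂ] V :=
    { toFun := fun v => η.structureFunction x ![s, v]
      map_add' := ((η.structureFunction x).curryLeft s).map_vecCons_add ![]
      map_smul' := ((η.structureFunction x).curryLeft s).map_vecCons_smul ![] }
  rw [(η.structureFunction x).map_vecCons_smul]
  refine Submodule.smul_mem _ a ?_
  have hle : affineTangentSpace Z α ≤ (affineTangentSpace Z α).comap T := by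
    refine Submodule.span_le.2 ?_
    rintro w ⟨c, hc0, hcα, hcZ, hcw⟩
    rw [hspan] at hcα
    obtain ⟨b, hb⟩ := Submodule.mem_span_singleton.1 hcα
    have hb0 : b ≠ 0 := by
      rintro rfl
      exact hc0 (by rw [← hb, zero_smul])
    obtain ⟨ν, hν⟩ := velocity_eq_of_slice hg hgs hs1 hb0 hb.symm (hcZ.mono fun _ h => h.2) hcw
    have hTs : T s = 0 :=
      (η.structureFunction x).map_eq_zero_of_eq ![s, s] (i := 0) (j := 1) rfl zero_ne_one
    have hTw : T w = T (fderiv ℂ g (L s) ν) := by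
      rw [hν, map_add, map_smul, hTs, smul_zero, add_zero]
    change T w ∈ affineTangentSpace Z α
    rw [hTw]
    exact hkey' ν
  exact hle hv

end Main

end ConicConnections

theorem proposition5p7
    {V : Type*} [NormedAddCommGroup V] [NormedSpace ℂ V] [FiniteDimensional ℂ V]
    (Z : Set (ℙ ℂ V)) (hZ : IsNonsingularProjectiveVariety Z)
    {E : Type*} [NormedAddCommGroup E] [NormedSpace ℂ E] [FiniteDimensional ℂ E]
    {M : Type*} [TopologicalSpace M] [ChartedSpace E M] [IsManifold 𝓘(ℂ, E) ω M]
    {B : Type*} [NormedAddCommGroup B] [NormedSpace ℂ B] [FiniteDimensional ℂ B]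
    (C : Set (ProjTangentBundle E M)) [ChartedSpace B C] [IsManifold 𝓘(ℂ, B) ω C]
    (hC : IsConeStructure (B := B) C) (hiso : IsIsotrivial Z C)
    (η : Coframe E M V) (hη : IsAdapted Z C η)
    (hΓ : IsCharacteristic (Gamma (B := B) C η)) :
    ∀ x : M, η.structureFunction x ∈ Xi Z :=
  fun x => structureFunction_mem_Xi hC hη hΓ x
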